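/- Conventions. Let $S$ be a finite monoid which is a right regular band of groups, i.e. $S$ is regular ($\forall s\,\exists t:\ sts=s$) and every right ideal of $S$ is a two-sided ideal. Write $s\le_{\mathscr J}t$ if $SsS\subseteq StS$; the associated equivalence classes are the $\mathscr J$-classes $J_1,\dots,J_n$ of $S$, partially ordered by $\le_{\mathscr J}$. For each $i$ choose an idempotent $e_i\in J_i$ and let $G_i$ be the group of units of the monoid $e_iSe_i$. Let $E(J_\ell)$ be the set of idempotents in $J_\ell$, let $s^\omega$ be the unique idempotent among the powers $s^n$, $n\ge 1$, and let $\mu$ be the Möbius function of the poset of principal right ideals $sS$ of $S$ ordered by inclusion, with $\mu(J_m,J_i):=\mu(e_mS,e_iS)$. Let $k$ be an algebraically closed field of characteristic $0$. All modules are right modules. For a $kG_i$-module $V$ put $$\mathrm{Ind}_i(V)=V\otimes_{kG_i}e_i\bigl(kS/kI_i\bigr),\qquad I_i=\{s\in S: e_i\not\le_{\mathscr J}s\},$$ a right $kS$-module, and let $\chi_V(g)$ be the trace of $v\mapsto vg$ on $V$. For projective indecomposable $kS$-modules $P,Q$ the Cartan invariant is $C_{PQ}=\dim_k\mathrm{Hom}_{kS}(P,Q)$.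 Theorem 5.5. Let $V$ be a simple $kG_i$-module and $W$ a simple $kG_\ell$-module, and set $P=\mathrm{Ind}_i(V)$, $Q=\mathrm{Ind}_\ell(W)$. Then $P$ and $Q$ are projective indecomposable $kS$-modules, and $$C_{PQ}=\begin{cases}\ast & \text{if } J_i>_{\mathscr J}J_\ell,\\ 1 & \text{if } i=\ell \text{ and } V\cong W,\\ 0&\text{otherwise,}\end{cases}$$ where $$\ast=\frac1{|G_i|}\sum_{g\in G_i}\chi_V(g^{-1})\sum_{J_\ell\le_{\mathscr J}J_m\le_{\mathscr J}J_i}\mu(J_m,J_i)\sum_{\substack{e\in E(J_\ell)\\(ege_m)^\omega=e}}\chi_W(ege_\ell).$$ (In the last sum $ege_\ell$ is an element of $G_\ell$.) -/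

import Mathlib

open scoped TensorProduct
open MulOpposite (op)

noncomputable section

namespace RRBG

universe u v w

/-! ### Principal ideals, the `J`-order, right regular bands of groups -/

section Green

variable {S : Type u} [Monoid S]

/-- The principal right ideal `sS`. -/
def rightIdeal (s : S) : Set S := {x | ∃ a, x = s * a}

/-- The principal two-sided ideal `SsS`. -/
def twoSidedIdeal (s : S) : Set S := {x | ∃ a b, x = a * s * b}

/-- Green's preorder: `s ≤_J t` if and only if `SsS ⊆ StS`. -/
def JLe (s t : S) : Prop := twoSidedIdeal s ⊆ twoSidedIdeal t

/-- `s <_J t`. -/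
def JLt (s t : S) : Prop := JLe s t ∧ ¬ JLe t s

/-- Green's relation: `s J t` if and only if `SsS = StS`. -/
def JEquiv (s t : S) : Prop := twoSidedIdeal s = twoSidedIdeal t

variable (S) in
/-- A right regular band of groups: a regular semigroup (here: monoid) in which every right ideal
is a two-sided ideal. -/
structure IsRightRegularBandOfGroups : Prop where
  regular : ∀ s : S, ∃ t : S, s * t * s = s
  right_ideal_two_sided : ∀ R : Set S, (∀ r ∈ R, ∀ s : S, r * s ∈ R) → ∀ r ∈ R, ∀ s : S, s * r ∈ R

variable (S) in
/-- The poset of principal right ideals of `S`, ordered by inclusion. -/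
abbrev PrincipalRightIdeals : Type u := ↥(Set.range (rightIdeal : S → Set S))

/-- The principal right ideal `sS` as an element of the poset of principal right ideals. -/
def principal (s : S) : PrincipalRightIdeals S := ⟨rightIdeal s, s, rfl⟩

open Classical in
/-- The Möbius function `μ(sS, tS)` of the finite poset of principal right ideals of `S`. -/
def moebius [Finite S] (s t : S) : ℤ :=
  letI : Fintype (PrincipalRightIdeals S) := Fintype.ofFinite _
  letI : LocallyFiniteOrder (PrincipalRightIdeals S) := Fintype.toLocallyFiniteOrder
  IncidenceAlgebra.mu ℤ (principal s) (principal t)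

theorem exists_idempotent_pow [Finite S] (s : S) : ∃ n : ℕ, 0 < n ∧ IsIdempotentElem (s ^ n) := by
  obtain ⟨a, b, hab, h⟩ : ∃ a b : ℕ, a < b ∧ s ^ a = s ^ b := by
    obtain ⟨a, b, hne, h⟩ := Finite.exists_ne_map_eq_of_infinite (fun n : ℕ => s ^ n)
    rcases lt_or_gt_of_ne hne with h1 | h1
    · exact ⟨a, b, h1, h⟩
    · exact ⟨b, a, h1, h.symm⟩
  obtain ⟨p, rfl⟩ := Nat.exists_eq_add_of_lt hab
  have step : ∀ m, a ≤ m → s ^ (m + (p + 1)) = s ^ m := by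
    intro m hm
    obtain ⟨c, rfl⟩ := Nat.exists_eq_add_of_le hm
    rw [show a + c + (p + 1) = (a + p + 1) + c by omega, pow_add, ← h, ← pow_add]
  have steps : ∀ j m, a ≤ m → s ^ (m + j * (p + 1)) = s ^ m := by
    intro j
    induction j with
    | zero => intro m _; simp
    | succ j ih =>
      intro m hm
      rw [show m + (j + 1) * (p + 1) = (m + j * (p + 1)) + (p + 1) by ring,
        step _ (le_trans hm (Nat.le_add_right _ _)), ih m hm]
  refine ⟨(a + 1) * (p + 1), by positivity, ?_⟩
  unfold IsIdempotentElem
  rw [← pow_add, steps]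
  nlinarith

/-- `s ^ ω`: the (unique) idempotent power of `s` with positive exponent. -/
def omegaPow [Finite S] (s : S) : S := s ^ (exists_idempotent_pow s).choose

theorem omegaPow_eq_iff [Finite S] (s e : S) :
    omegaPow s = e ↔ IsIdempotentElem e ∧ ∃ n : ℕ, 0 < n ∧ s ^ n = e := by
  have hspec := (exists_idempotent_pow s).choose_spec
  constructor
  · rintro rfl
    exact ⟨hspec.2, _, hspec.1, rfl⟩
  · rintro ⟨he, n, hn, rfl⟩
    have h1 := he.pow_eq hspec.1.ne'
    have h2 := hspec.2.pow_eq hn.ne'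
    rw [← pow_mul] at h1 h2
    rw [omegaPow, ← h2, ← h1, mul_comm]

variable (S) in
/-- The set `E(S)` of idempotents of `S`. -/
abbrev Idem : Type u := {e : S // IsIdempotentElem e}

/-- The monoid `eSe`, with identity `e`, for an idempotent `e`. -/
def LocalMonoid (e : Idem S) : Type u := {x : S // e.1 * x = x ∧ x * e.1 = x}

instance (e : Idem S) : Monoid (LocalMonoid e) where
  mul x y := ⟨x.1 * y.1, by rw [← mul_assoc, x.2.1], by rw [mul_assoc, y.2.2]⟩
  one := ⟨e.1, e.2, e.2⟩
  mul_assoc x y z := Subtype.ext (mul_assoc x.1 y.1 z.1)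
  one_mul x := Subtype.ext x.2.1
  mul_one x := Subtype.ext x.2.2

instance [Finite S] (e : Idem S) : Finite (LocalMonoid e) := Subtype.finite

/-- The maximal subgroup `G_e` of `S` at the idempotent `e`: the group of units of `eSe`. -/
abbrev MaxSubgroup (e : Idem S) : Type u := (LocalMonoid e)ˣ

instance [Finite S] (e : Idem S) : Fintype (MaxSubgroup e) := Fintype.ofFinite _

/-- The element of `S` underlying an element of the maximal subgroup at `e`. -/
def MaxSubgroup.toS {e : Idem S} (g : MaxSubgroup e) : S := g.val.1

theorem MaxSubgroup.toS_mul {e : Idem S} (g h : MaxSubgroup e) :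
    (g * h).toS = g.toS * h.toS := rfl

theorem MaxSubgroup.toS_one {e : Idem S} : (1 : MaxSubgroup e).toS = e.1 := rfl

/-- The idempotents `e 1, …, e n` form a set of representatives of the `J`-classes of `S`. -/
def IsJTransversal {n : ℕ} (e : Fin n → Idem S) : Prop :=
  ∀ s : S, ∃! i : Fin n, JEquiv s (e i).1

end Green

/-! ### Right modules and Cartan invariants

Right modules over a ring `A` are modules over `Aᵐᵒᵖ`; thus `op a • m` is `m · a`. -/

section Modules

/-- A right `A`-module is a projective indecomposable module. -/
structure IsProjectiveIndecomposable (A : Type u) [Ring A] (P : Type v) [AddCommGroup P]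
    [Module Aᵐᵒᵖ P] : Prop where
  projective : Module.Projective Aᵐᵒᵖ P
  nontrivial : Nontrivial P
  indecomposable : ∀ N N' : Submodule Aᵐᵒᵖ P, IsCompl N N' → N = ⊥ ∨ N' = ⊥

/-- The Cartan invariant `C_{PQ} = dim Hom_A(P, Q)` of two (projective indecomposable) right
modules over a `k`-algebra `A`. -/
def cartanInvariant (k : Type u) [Field k] (A : Type v) [Ring A] [Algebra k A]
    (P : Type*) (Q : Type*) [AddCommGroup P] [AddCommGroup Q] [Module Aᵐᵒᵖ P] [Module Aᵐᵒᵖ Q]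
    [Module k Q] [IsScalarTower k Aᵐᵒᵖ Q] : ℕ :=
  Module.finrank k (P →ₗ[Aᵐᵒᵖ] Q)

end Modules

/-! ### The induced modules -/

section Induced

variable (k : Type v) [Field k] {S : Type u} [Monoid S]

/-- The right ideal `e kS` of `kS`. -/
def cornerIdeal (e : Idem S) : Submodule (MonoidAlgebra k S)ᵐᵒᵖ (MonoidAlgebra k S) :=
  Submodule.span _ {MonoidAlgebra.single e.1 1}

/-- The ideal `kI` of `kS`, where `I = {s | ¬ e ≤_J s}`, viewed as a right ideal. As `I` is an
ideal of `S`, the right ideal generated by `I` is the `k`-span of `I`. -/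
def notUpIdeal (e : Idem S) : Submodule (MonoidAlgebra k S)ᵐᵒᵖ (MonoidAlgebra k S) :=
  Submodule.span _ {x | ∃ s : S, ¬ JLe e.1 s ∧ x = MonoidAlgebra.single s 1}

/-- The `kG_e`-`kS`-bimodule `e(kS/kI) = ekS/(ekS ∩ kI)`, where `I = {s | ¬ e ≤_J s}`. -/
def IndBimodule (e : Idem S) : Type (max u v) :=
  ↥(cornerIdeal k e) ⧸ (notUpIdeal k e).submoduleOf (cornerIdeal k e)

instance (e : Idem S) : AddCommGroup (IndBimodule k e) :=
  inferInstanceAs (AddCommGroup (↥(cornerIdeal k e) ⧸ (notUpIdeal k e).submoduleOf _))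

/-- The right action of `kS` on `e(kS/kI)`. -/
instance (e : Idem S) : Module (MonoidAlgebra k S)ᵐᵒᵖ (IndBimodule k e) :=
  inferInstanceAs (Module _ (↥(cornerIdeal k e) ⧸ (notUpIdeal k e).submoduleOf _))

instance (e : Idem S) : Module k (IndBimodule k e) :=
  inferInstanceAs (Module k (↥(cornerIdeal k e) ⧸ (notUpIdeal k e).submoduleOf _))

instance (e : Idem S) : IsScalarTower k (MonoidAlgebra k S)ᵐᵒᵖ (IndBimodule k e) :=
  inferInstanceAs (IsScalarTower k _ (↥(cornerIdeal k e) ⧸ (notUpIdeal k e).submoduleOf _))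

variable {k} in
theorem mem_cornerIdeal_iff {e : Idem S} {x : MonoidAlgebra k S} :
    x ∈ cornerIdeal k e ↔ MonoidAlgebra.single e.1 1 * x = x := by
  rw [cornerIdeal, Submodule.mem_span_singleton]
  constructor
  · rintro ⟨a, rfl⟩
    rw [MulOpposite.smul_eq_mul_unop, ← mul_assoc, MonoidAlgebra.single_mul_single, e.2.eq, mul_one]
  · intro h
    exact ⟨op x, by rw [MulOpposite.smul_eq_mul_unop]; exact h⟩

/-- Left multiplication by an element of `G_e` on `kS`. -/
def leftMulS {e : Idem S} (g : MaxSubgroup e) :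
    Module.End (MonoidAlgebra k S)ᵐᵒᵖ (MonoidAlgebra k S) :=
  Module.toModuleEnd _ _ (MonoidAlgebra.single g.toS (1 : k) : MonoidAlgebra k S)

theorem leftMulS_apply {e : Idem S} (g : MaxSubgroup e) (x : MonoidAlgebra k S) :
    leftMulS k g x = MonoidAlgebra.single g.toS 1 * x := rfl

theorem leftMulS_mem {e : Idem S} (g : MaxSubgroup e) (x : MonoidAlgebra k S)
    (_hx : x ∈ cornerIdeal k e) : leftMulS k g x ∈ cornerIdeal k e := by
  rw [mem_cornerIdeal_iff, leftMulS_apply, ← mul_assoc, MonoidAlgebra.single_mul_single, mul_one,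
    show e.1 * g.toS = g.toS from g.val.2.1]

theorem leftMulS_mem_notUp {e : Idem S} (g : MaxSubgroup e) (x : MonoidAlgebra k S)
    (hx : x ∈ notUpIdeal k e) : leftMulS k g x ∈ notUpIdeal k e := by
  have : notUpIdeal k e ≤ (notUpIdeal k e).comap (leftMulS k g) := by
    refine Submodule.span_le.2 ?_
    rintro _ ⟨s, hs, rfl⟩
    refine Submodule.subset_span ⟨g.toS * s, fun h => hs (h.trans ?_), ?_⟩
    · rintro _ ⟨a, b, rfl⟩
      exact ⟨a * g.toS, b, by simp only [mul_assoc]⟩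
    · rw [leftMulS_apply, MonoidAlgebra.single_mul_single, mul_one]
  exact this hx

/-- Left multiplication by an element of `G_e` on `e(kS/kI)`, as an endomorphism of right
`kS`-modules. -/
def leftMul {e : Idem S} (g : MaxSubgroup e) :
    Module.End (MonoidAlgebra k S)ᵐᵒᵖ (IndBimodule k e) :=
  Submodule.mapQ ((notUpIdeal k e).submoduleOf (cornerIdeal k e))
    ((notUpIdeal k e).submoduleOf (cornerIdeal k e))
    ((leftMulS k g).restrict (leftMulS_mem k g)) (fun x hx => leftMulS_mem_notUp k g x hx)

/-- Left multiplication as a homomorphism from `G_e` to the endomorphisms of the right `kS`-module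
`e(kS/kI)`. -/
def leftMulHom (e : Idem S) :
    MaxSubgroup e →* Module.End (MonoidAlgebra k S)ᵐᵒᵖ (IndBimodule k e) where
  toFun := leftMul k
  map_one' := by
    ext x
    obtain ⟨x, rfl⟩ := Submodule.Quotient.mk_surjective _ x
    refine congrArg (Submodule.Quotient.mk) (Subtype.ext ?_)
    exact mem_cornerIdeal_iff.1 x.2
  map_mul' g h := by
    ext x
    obtain ⟨x, rfl⟩ := Submodule.Quotient.mk_surjective _ x
    refine congrArg (Submodule.Quotient.mk) (Subtype.ext ?_)
    change MonoidAlgebra.single _ 1 * x.1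
      = MonoidAlgebra.single _ 1 * (MonoidAlgebra.single _ 1 * x.1)
    rw [← mul_assoc, MonoidAlgebra.single_mul_single, mul_one, MaxSubgroup.toS_mul]

/-- The left action of `kG_e` on `e(kS/kI)`, by left multiplication. -/
instance (e : Idem S) : Module (MonoidAlgebra k (MaxSubgroup e)) (IndBimodule k e) :=
  Module.compHom _ (MonoidAlgebra.lift k
    (Module.End (MonoidAlgebra k S)ᵐᵒᵖ (IndBimodule k e)) (MaxSubgroup e) (leftMulHom k e)).toRingHom

/-- The projection `ekS → e(kS/kI)`. -/
def IndBimodule.mk (e : Idem S) : cornerIdeal k e →ₗ[(MonoidAlgebra k S)ᵐᵒᵖ] IndBimodule k e :=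
  Submodule.mkQ _

theorem single_smul_mk {e : Idem S} (g : MaxSubgroup e) (x : cornerIdeal k e) :
    (MonoidAlgebra.single g 1 : MonoidAlgebra k (MaxSubgroup e)) • IndBimodule.mk k e x =
      IndBimodule.mk k e ⟨MonoidAlgebra.single g.toS 1 * x.1, leftMulS_mem k g x.1 x.2⟩ := by
  change (MonoidAlgebra.lift k (Module.End (MonoidAlgebra k S)ᵐᵒᵖ (IndBimodule k e))
    (MaxSubgroup e) (leftMulHom k e)) (MonoidAlgebra.single g 1) (IndBimodule.mk k e x) = _
  rw [MonoidAlgebra.lift_single, one_smul]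
  rfl

/-- The tensor product `V ⊗_B M` over a (noncommutative) `k`-algebra `B` of a right `B`-module `V`
and a `B`-`A`-bimodule `M`, as a right `A`-module: the quotient of the tensor product over `k` by
the relations `v · b ⊗ m = v ⊗ b · m`. The factors are written in the opposite order, so that the
right `A`-module structure is the one that Mathlib puts on a tensor product through its first
factor. -/
def BalancedTensor (B : Type*) (A : Type*) (V : Type*) (M : Type*) [Ring B] [Algebra k B] [Ring A]
    [Algebra k A] [AddCommGroup V] [Module k V] [Module Bᵐᵒᵖ V] [AddCommGroup M] [Module k M]
    [Module B M] [Module Aᵐᵒᵖ M] [IsScalarTower k Aᵐᵒᵖ M] : Type _ :=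
  (M ⊗[k] V) ⧸ (Submodule.span Aᵐᵒᵖ
    {z : M ⊗[k] V | ∃ (v : V) (b : B) (m : M), z = m ⊗ₜ[k] (op b • v) - (b • m) ⊗ₜ[k] v})

section

variable (B : Type*) (A : Type*) (V : Type*) (M : Type*) [Ring B] [Algebra k B] [Ring A]
    [Algebra k A] [AddCommGroup V] [Module k V] [Module Bᵐᵒᵖ V] [AddCommGroup M] [Module k M]
    [Module B M] [Module Aᵐᵒᵖ M] [IsScalarTower k Aᵐᵒᵖ M]

instance : AddCommGroup (BalancedTensor k B A V M) :=
  inferInstanceAs (AddCommGroup ((M ⊗[k] V) ⧸ (Submodule.span Aᵐᵒᵖ _)))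

instance : Module Aᵐᵒᵖ (BalancedTensor k B A V M) :=
  inferInstanceAs (Module Aᵐᵒᵖ ((M ⊗[k] V) ⧸ (Submodule.span Aᵐᵒᵖ _)))

instance : Module k (BalancedTensor k B A V M) :=
  inferInstanceAs (Module k ((M ⊗[k] V) ⧸ (Submodule.span Aᵐᵒᵖ _)))

instance : IsScalarTower k Aᵐᵒᵖ (BalancedTensor k B A V M) :=
  inferInstanceAs (IsScalarTower k Aᵐᵒᵖ ((M ⊗[k] V) ⧸ (Submodule.span Aᵐᵒᵖ _)))

end

variable (e : Idem S) (V : Type w) [AddCommGroup V] [Module k V]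
  [Module (MonoidAlgebra k (MaxSubgroup e))ᵐᵒᵖ V]

/-- The induced right `kS`-module `Ind_e(V) = V ⊗_{kG_e} e(kS/kI)` of a right `kG_e`-module `V`,
where `I = {s | ¬ e ≤_J s}`. -/
abbrev Ind : Type _ :=
  BalancedTensor k (MonoidAlgebra k (MaxSubgroup e)) (MonoidAlgebra k S) V (IndBimodule k e)

variable [IsScalarTower k (MonoidAlgebra k (MaxSubgroup e))ᵐᵒᵖ V]

/-- The character `χ_V` of a right `kG_e`-module `V`: `χ_V(g)` is the trace of `v ↦ v · g`. -/
def character (g : MaxSubgroup e) : k :=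
  LinearMap.trace k V (Algebra.lsmul k k V
    (op (MonoidAlgebra.single g 1 : MonoidAlgebra k (MaxSubgroup e))))

open Classical in
/-- The character `χ_V` as a function of elements of `S`: the value at `s` is `χ_V(s)` if
`s ∈ G_e`, and `0` otherwise. -/
def characterS (s : S) : k :=
  if h : ∃ g : MaxSubgroup e, g.toS = s then character k e V h.choose else 0

theorem characterS_toS (g : MaxSubgroup e) : characterS k e V g.toS = character k e V g := by
  have h : ∃ g' : MaxSubgroup e, g'.toS = g.toS := ⟨g, rfl⟩
  have h2 : h.choose = g := Units.ext (Subtype.ext h.choose_spec)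
  rw [characterS, dif_pos h, h2]

end Induced

/-- In a finite right regular band of groups, `f g e_ℓ` lies in the maximal subgroup at `e_ℓ`
whenever `f` is an idempotent in the `J`-class of `e_ℓ` and `g` belongs to a maximal subgroup at an
idempotent `e_i` with `e_ℓ ≤_J e_i`. -/
theorem exists_toS_eq {S : Type u} [Monoid S] [Finite S] (hS : IsRightRegularBandOfGroups S)
    (ei el : Idem S) (hle : JLe el.1 ei.1) (g : MaxSubgroup ei) (f : S)
    (hf : JEquiv f el.1) : ∃ h : MaxSubgroup el, h.toS = f * g.toS * el.1 := by
  have ideal : ∀ a x s : S, x ∈ rightIdeal a → s * x ∈ rightIdeal a := fun a x s hx =>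
    hS.right_ideal_two_sided (rightIdeal a)
      (by rintro _ ⟨c, rfl⟩ t; exact ⟨c * t, mul_assoc _ _ _⟩) x hx s
  have hself : ∀ a : S, a ∈ rightIdeal a := fun a => ⟨1, (mul_one a).symm⟩
  have two : ∀ a x : S, x ∈ twoSidedIdeal a → x ∈ rightIdeal a := by
    rintro a _ ⟨c, d, rfl⟩
    obtain ⟨t, ht⟩ := ideal a a c (hself a)
    exact ⟨t * d, by rw [ht, mul_assoc]⟩
  have hmul : ∀ a b y : S, y ∈ rightIdeal a → y ∈ rightIdeal b → y ∈ rightIdeal (a * b) := by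
    rintro a b y ⟨u, rfl⟩ hb
    obtain ⟨a', ha'⟩ := hS.regular a
    obtain ⟨t, ht⟩ := ideal b _ a' hb
    refine ⟨t, ?_⟩
    rw [mul_assoc, ← ht, ← mul_assoc, ← mul_assoc, ha']
  have hmem2 : ∀ a : S, a ∈ twoSidedIdeal a := fun a => ⟨1, 1, by simp⟩
  have h1 : el.1 ∈ rightIdeal f := two _ _ (by rw [hf]; exact hmem2 _)
  have h2 : el.1 ∈ rightIdeal g.toS := by
    obtain ⟨t, ht⟩ := two _ _ (hle (hmem2 _))
    refine ⟨(g⁻¹).toS * t, ?_⟩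
    rw [← mul_assoc, ← MaxSubgroup.toS_mul, mul_inv_cancel, MaxSubgroup.toS_one, ← ht]
  obtain ⟨t, ht⟩ := hmul _ _ _ (hmul _ _ _ h1 h2) (hself el.1)
  have hx1 : el.1 * (f * g.toS * el.1) = f * g.toS * el.1 := by
    obtain ⟨c, hc⟩ := ideal el.1 el.1 (f * g.toS) (hself _)
    rw [hc, ← mul_assoc, el.2.eq]
  have hx2 : f * g.toS * el.1 * el.1 = f * g.toS * el.1 := by rw [mul_assoc, el.2.eq]
  let x : LocalMonoid el := ⟨f * g.toS * el.1, hx1, hx2⟩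
  let y : LocalMonoid el := ⟨el.1 * t * el.1, by rw [← mul_assoc, ← mul_assoc, el.2.eq],
    by rw [mul_assoc, el.2.eq]⟩
  have hxy : x * y = 1 := Subtype.ext (by
    change f * g.toS * el.1 * (el.1 * t * el.1) = el.1
    rw [← mul_assoc, ← mul_assoc, hx2, ← ht, el.2.eq])
  have hyx : y * x = 1 := by
    have hinj : Function.Injective (fun z : LocalMonoid el => y * z) := fun z z' h => by
      have h' := congrArg (x * ·) h
      simpa only [← mul_assoc, hxy, one_mul] using h'
    obtain ⟨z, hz⟩ := Finite.surjective_of_injective hinj 1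
    have hz' : y * z = 1 := hz
    have : x = z := by rw [← mul_one x, ← hz', ← mul_assoc, hxy, one_mul]
    rw [this, hz']
  exact ⟨⟨x, y, hxy, hyx⟩, rfl⟩

/-! ### The Cartan matrix formula -/

open Classical in
/-- The character formula
`1/|G_i| ∑_{g ∈ G_i} χ_V(g⁻¹) ∑_{J_ℓ ≤ J_m ≤ J_i} μ(J_m, J_i)
  ∑_{f ∈ E(J_ℓ), (f g e_m)^ω = f} χ_W(f g e_ℓ)`. -/
def cartanFormula (k : Type v) [Field k] {S : Type u} [Monoid S] [Fintype S] {n : ℕ}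
    (e : Fin n → Idem S) (i l : Fin n)
    (V : Type*) [AddCommGroup V] [Module k V] [Module (MonoidAlgebra k (MaxSubgroup (e i)))ᵐᵒᵖ V]
    [IsScalarTower k (MonoidAlgebra k (MaxSubgroup (e i)))ᵐᵒᵖ V]
    (W : Type*) [AddCommGroup W] [Module k W] [Module (MonoidAlgebra k (MaxSubgroup (e l)))ᵐᵒᵖ W]
    [IsScalarTower k (MonoidAlgebra k (MaxSubgroup (e l)))ᵐᵒᵖ W] : k :=
  (1 / (Nat.card (MaxSubgroup (e i)) : k)) *
    ∑ g : MaxSubgroup (e i), character k (e i) V g⁻¹ *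
      ∑ m : Fin n with JLe (e l).1 (e m).1 ∧ JLe (e m).1 (e i).1,
        (moebius (e m).1 (e i).1 : k) *
          ∑ f : S with IsIdempotentElem f ∧ JEquiv f (e l).1 ∧
              omegaPow (f * g.toS * (e m).1) = f,
            characterS k (e l) W (f * g.toS * (e l).1)

/-- The pairs `(i, V)` and `(ℓ, W)` agree: `i = ℓ` and `V ≅ W` as right modules over the group
algebra of `G_i = G_ℓ`. -/
def SameModule (k : Type v) [Field k] {S : Type u} [Monoid S] {n : ℕ}
    (e : Fin n → Idem S) (i l : Fin n)
    (V : Type*) [AddCommGroup V] [Module k V] [Module (MonoidAlgebra k (MaxSubgroup (e i)))ᵐᵒᵖ V]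
    (W : Type*) [AddCommGroup W] [Module k W]
    [Module (MonoidAlgebra k (MaxSubgroup (e l)))ᵐᵒᵖ W] : Prop :=
  i = l ∧ ∃ φ : V ≃ₗ[k] W, ∀ (g : MaxSubgroup (e i)) (h : MaxSubgroup (e l)), g.toS = h.toS →
    ∀ v : V, φ (op (MonoidAlgebra.single g (1 : k)) • v) =
      op (MonoidAlgebra.single h (1 : k)) • φ v

end RRBG

end

open RRBG

/-
The functor `Ind_e` from right `kG_e`-modules to right `kS`-modules has a right adjoint, which sends
`N` to the subspace `{n | ne = n, nI = 0}`. For `N = Ind_e(V)` this subspace is a copy of `V`, so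
`Ind_e(V)` has no nontrivial idempotent endomorphisms when `V` is simple. The right adjoint is exact
because the class of `e` in `e(kS/kI)` lifts to some `η ∈ kS` with `ηe = η` and `ηI = 0`, and right
multiplication by `η` projects `N` onto the subspace; hence `Ind_e` preserves projectivity.

By adjunction `C_PQ` is the dimension of a space of `kG_i`-homomorphisms from `V` to `Q η_i`, which
is an inner product of characters, and the character of `Q η_i` at `g` is the trace of `η_i g` on
`Q`. A trace function `τ` satisfies `τ(x e_m) = ∑ τ(η_j x)` over `J_j ≤ J_m`, so Möbius inversion
gives `τ(η_i g)` in terms of the traces of `g e_m`, and these can be read off the decomposition of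
`Q = Ind_l(W)` as the direct sum of the `W ⊗ f` over the idempotents `f ∈ J_l`.
-/

noncomputable section

namespace RRBG

/-! ### Green's `J`-order -/

section JOrder

variable {S : Type*} [Monoid S]

theorem JLe.refl (s : S) : JLe s s := Set.Subset.refl _

theorem JLe.trans {s t r : S} (h : JLe s t) (h' : JLe t r) : JLe s r := Set.Subset.trans h h'

theorem jEquiv_iff {s t : S} : JEquiv s t ↔ JLe s t ∧ JLe t s := Set.Subset.antisymm_iff

theorem JEquiv.le {s t : S} (h : JEquiv s t) : JLe s t := h.subset

theorem JEquiv.ge {s t : S} (h : JEquiv s t) : JLe t s := h.superset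

theorem mul_jLe_left (s t : S) : JLe (s * t) s := by
  rintro _ ⟨a, b, rfl⟩
  exact ⟨a, t * b, by simp only [mul_assoc]⟩

theorem mul_jLe_right (s t : S) : JLe (s * t) t := by
  rintro _ ⟨a, b, rfl⟩
  exact ⟨a * s, b, by simp only [mul_assoc]⟩

namespace IsRightRegularBandOfGroups

variable (hS : IsRightRegularBandOfGroups S)
include hS

theorem exists_mul_eq (a s : S) : ∃ t, s * a = a * t :=
  hS.right_ideal_two_sided (rightIdeal a)
    (by rintro _ ⟨c, rfl⟩ t; exact ⟨c * t, mul_assoc _ _ _⟩) a ⟨1, (mul_one a).symm⟩ s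

theorem rightIdeal_eq_twoSidedIdeal (s : S) : rightIdeal s = twoSidedIdeal s := by
  refine Set.Subset.antisymm ?_ ?_
  · rintro _ ⟨a, rfl⟩
    exact ⟨1, a, by rw [one_mul]⟩
  · rintro _ ⟨c, d, rfl⟩
    obtain ⟨t, ht⟩ := hS.exists_mul_eq s c
    exact ⟨t * d, by rw [ht, mul_assoc]⟩

theorem jLe_iff_exists {s t : S} : JLe s t ↔ ∃ a, s = t * a := by
  refine ⟨fun h => ?_, ?_⟩
  · have hs : s ∈ twoSidedIdeal t := h ⟨1, 1, by rw [one_mul, mul_one]⟩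
    rwa [← hS.rightIdeal_eq_twoSidedIdeal] at hs
  · rintro ⟨a, rfl⟩
    exact mul_jLe_left t a

theorem jLe_idem_iff {s e : S} (he : IsIdempotentElem e) : JLe s e ↔ e * s = s := by
  rw [hS.jLe_iff_exists]
  refine ⟨?_, fun h => ⟨s, h.symm⟩⟩
  rintro ⟨a, rfl⟩
  rw [← mul_assoc, he.eq]

theorem jLe_mul_iff {s a b : S} : JLe s (a * b) ↔ JLe s a ∧ JLe s b := by
  refine ⟨fun h => ⟨h.trans (mul_jLe_left _ _), h.trans (mul_jLe_right _ _)⟩, ?_⟩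
  rintro ⟨ha, hb⟩
  obtain ⟨u, rfl⟩ := hS.jLe_iff_exists.1 ha
  obtain ⟨c, hc⟩ := hS.jLe_iff_exists.1 hb
  obtain ⟨a', ha'⟩ := hS.regular a
  obtain ⟨t, ht⟩ := hS.exists_mul_eq b a'
  refine hS.jLe_iff_exists.2 ⟨t * c, ?_⟩
  calc a * u = a * (a' * (a * u)) := by rw [← mul_assoc, ← mul_assoc, ha']
    _ = a * (a' * b * c) := by rw [hc, mul_assoc]
    _ = a * b * (t * c) := by rw [ht]; simp only [mul_assoc]

theorem jLe_pow {s t : S} (h : JLe s t) {n : ℕ} (hn : 0 < n) : JLe s (t ^ n) := by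
  induction n, hn using Nat.le_induction with
  | base => rwa [pow_one]
  | succ n _ ih => rw [pow_succ]; exact hS.jLe_mul_iff.2 ⟨ih, h⟩

section Finite

variable [Finite S]

theorem omegaPow_jEquiv (s : S) : JEquiv (omegaPow s) s := by
  obtain ⟨n, hn, h⟩ := ((omegaPow_eq_iff s _).1 rfl).2
  rw [jEquiv_iff, ← h]
  refine ⟨?_, hS.jLe_pow (JLe.refl s) hn⟩
  rw [← mul_pow_sub_one hn.ne']
  exact mul_jLe_left _ _

theorem mul_omegaPow (s : S) : s * omegaPow s = s := by
  obtain ⟨hω, n, -, h⟩ := (omegaPow_eq_iff s _).1 rfl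
  calc s * omegaPow s = omegaPow s * s := by rw [← h, pow_mul_comm']
    _ = s := (hS.jLe_idem_iff hω).1 (hS.omegaPow_jEquiv s).ge

theorem omegaPow_mul {x y : S} (h : JEquiv x y) : omegaPow (x * y) = omegaPow y := by
  obtain ⟨hω, n, hn, hxy⟩ := (omegaPow_eq_iff (x * y) _).1 rfl
  have hle : JLe (omegaPow y) (omegaPow (x * y)) :=
    (hS.omegaPow_jEquiv y).le.trans
      ((hS.jLe_mul_iff.2 ⟨h.ge, JLe.refl y⟩).trans (hS.omegaPow_jEquiv _).ge)
  have hpow : (x * y) ^ n * omegaPow y = (x * y) ^ n := by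
    rw [← pow_sub_mul_pow (x * y) hn, pow_one, mul_assoc, mul_assoc x, hS.mul_omegaPow]
  rw [← (hS.jLe_idem_iff hω).1 hle, ← hxy, hpow]

theorem omegaPow_idem_mul_eq_iff {e f s : S} :
    JLe e (f * s) ∧ omegaPow (e * (f * s)) = f ↔
      IsIdempotentElem f ∧ JEquiv f e ∧ omegaPow (f * s) = f := by
  have hω : JLe e (f * s) → JLe f e → omegaPow (e * (f * s)) = omegaPow (f * s) := fun h h' =>
    hS.omegaPow_mul (jEquiv_iff.2 ⟨h, (mul_jLe_left f s).trans h'⟩)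
  constructor
  · rintro ⟨h, hf⟩
    have hJ : JEquiv f e := jEquiv_iff.2
      ⟨hf ▸ (hS.omegaPow_jEquiv _).le.trans (mul_jLe_left _ _), h.trans (mul_jLe_left _ _)⟩
    exact ⟨((omegaPow_eq_iff _ _).1 hf).1, hJ, hω h hJ.le ▸ hf⟩
  · rintro ⟨-, hJ, hf⟩
    have h : JLe e (f * s) := hJ.ge.trans <| by
      simpa only [hf] using (hS.omegaPow_jEquiv (f * s)).le
    exact ⟨h, (hω h hJ.le).trans hf⟩

end Finite

end IsRightRegularBandOfGroups

namespace MaxSubgroup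

variable {e : Idem S}

theorem toS_injective : Function.Injective (toS : MaxSubgroup e → S) :=
  fun _ _ h => Units.ext (Subtype.ext h)

theorem mul_toS (g : MaxSubgroup e) : e.1 * g.toS = g.toS := g.val.2.1

theorem toS_mul_idem (g : MaxSubgroup e) : g.toS * e.1 = g.toS := g.val.2.2

theorem jEquiv_toS (g : MaxSubgroup e) : JEquiv e.1 g.toS := by
  refine jEquiv_iff.2 ⟨?_, ?_⟩
  · rw [← toS_one, ← mul_inv_cancel g, toS_mul]
    exact mul_jLe_left _ _
  · rw [← g.mul_toS]
    exact mul_jLe_left _ _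

end MaxSubgroup

open Classical in
/-- The retraction `s ↦ se` of `{s | e ≤_J s}` onto `G_e`, with the junk value `1` if `se` does not
lie in `G_e`. -/
def toMaxSubgroup (e : Idem S) (s : S) : MaxSubgroup e :=
  if h : ∃ g : MaxSubgroup e, g.toS = s * e.1 then h.choose else 1

namespace IsRightRegularBandOfGroups

variable (hS : IsRightRegularBandOfGroups S) [Finite S] {e : Idem S}
include hS

theorem toS_toMaxSubgroup {s : S} (h : JLe e.1 s) : (toMaxSubgroup e s).toS = s * e.1 := by
  have hJ : JEquiv (s * e.1) e.1 :=
    jEquiv_iff.2 ⟨mul_jLe_right _ _, hS.jLe_mul_iff.2 ⟨h, JLe.refl _⟩⟩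
  have hs : ∃ g : MaxSubgroup e, g.toS = s * e.1 := by
    simpa only [MaxSubgroup.toS_one, mul_assoc, e.2.eq] using
      exists_toS_eq hS e e (JLe.refl _) 1 (s * e.1) hJ
  rw [toMaxSubgroup, dif_pos hs, hs.choose_spec]

theorem toMaxSubgroup_toS (g : MaxSubgroup e) : toMaxSubgroup e g.toS = g :=
  MaxSubgroup.toS_injective <| by rw [hS.toS_toMaxSubgroup g.jEquiv_toS.le, g.toS_mul_idem]

theorem toMaxSubgroup_mul {s t : S} (hs : JLe e.1 s) (ht : JLe e.1 t) :
    toMaxSubgroup e (s * t) = toMaxSubgroup e s * toMaxSubgroup e t :=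
  MaxSubgroup.toS_injective <| by
    rw [hS.toS_toMaxSubgroup (hS.jLe_mul_iff.2 ⟨hs, ht⟩), MaxSubgroup.toS_mul,
      hS.toS_toMaxSubgroup hs, mul_assoc, mul_assoc, MaxSubgroup.mul_toS, hS.toS_toMaxSubgroup ht]

theorem toMaxSubgroup_eq_one {f : S} (hf : IsIdempotentElem f) (h : JEquiv f e.1) :
    toMaxSubgroup e f = 1 :=
  MaxSubgroup.toS_injective <| by
    rw [hS.toS_toMaxSubgroup h.ge, MaxSubgroup.toS_one, (hS.jLe_idem_iff hf).1 h.ge]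

end IsRightRegularBandOfGroups

end JOrder

/-! ### Right modules over monoid algebras -/

section RightModules

variable (k : Type*) [Field k] {S : Type*} [Monoid S]

/-- The element `s` of `kS` as a scalar: `rsingle k s • m` is the element `m · s` of a right
`kS`-module. -/
abbrev rsingle (s : S) : (MonoidAlgebra k S)ᵐᵒᵖ := op (MonoidAlgebra.single s 1)

theorem rsingle_mul (s t : S) : rsingle k (s * t) = rsingle k t * rsingle k s := by
  rw [rsingle, ← MulOpposite.op_mul, MonoidAlgebra.single_mul_single, one_mul]

variable {k}

theorem single_eq_smul (s : S) (c : k) :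
    (MonoidAlgebra.single s c : MonoidAlgebra k S) = c • MonoidAlgebra.single s 1 := by
  rw [MonoidAlgebra.smul_single, smul_eq_mul, mul_one]

variable {M N : Type*} [AddCommGroup M] [Module (MonoidAlgebra k S)ᵐᵒᵖ M]
  [AddCommGroup N] [Module (MonoidAlgebra k S)ᵐᵒᵖ N]

theorem rsingle_one_smul (m : M) : rsingle k (1 : S) • m = m := one_smul (MonoidAlgebra k S)ᵐᵒᵖ m

theorem rsingle_mul_smul (s t : S) (m : M) :
    rsingle k (s * t) • m = rsingle k t • rsingle k s • m := by
  rw [rsingle_mul, mul_smul]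

variable [Module k M] [IsScalarTower k (MonoidAlgebra k S)ᵐᵒᵖ M]
  [Module k N] [IsScalarTower k (MonoidAlgebra k S)ᵐᵒᵖ N]

theorem op_single_smul (s : S) (c : k) (m : M) :
    op (MonoidAlgebra.single s c) • m = c • rsingle k s • m := by
  rw [single_eq_smul, MulOpposite.op_smul, smul_assoc]

/-- A `k`-linear map commuting with the right action of `S`, as a `kS`-linear map. -/
def rightLinear (f : M →ₗ[k] N) (h : ∀ (s : S) m, f (rsingle k s • m) = rsingle k s • f m) :
    M →ₗ[(MonoidAlgebra k S)ᵐᵒᵖ] N where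
  __ := f.toAddHom
  map_smul' a m := by
    obtain ⟨a, rfl⟩ := MulOpposite.op_surjective a
    change f (op a • m) = op a • f m
    induction a using MonoidAlgebra.induction_linear with
    | zero => simp only [MulOpposite.op_zero, zero_smul, map_zero]
    | add x y hx hy => rw [MulOpposite.op_add, add_smul, add_smul, map_add, hx, hy]
    | single s c => rw [op_single_smul s c m, op_single_smul s c (f m), map_smul, h]

theorem rightLinear_apply (f : M →ₗ[k] N) (h) (m : M) : rightLinear (S := S) f h m = f m := rfl

variable (k M) in
/-- The trace on a right `kS`-module of the action of an element of `kS`. -/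
def actionTrace : MonoidAlgebra k S →ₗ[k] k :=
  LinearMap.trace k M ∘ₗ (Algebra.lsmul k k M).toLinearMap ∘ₗ
    (MulOpposite.opLinearEquiv k).toLinearMap

theorem actionTrace_apply (x : MonoidAlgebra k S) :
    actionTrace k M x = LinearMap.trace k M (Algebra.lsmul k k M (op x)) := rfl

theorem actionTrace_mul_comm (x y : MonoidAlgebra k S) :
    actionTrace k M (x * y) = actionTrace k M (y * x) := by
  simp only [actionTrace_apply, MulOpposite.op_mul, map_mul, LinearMap.trace_mul_comm]

end RightModules

/-! ### The ideal `kI` and the right adjoint of induction -/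

section NotUpIdeal

variable {k : Type*} [Field k] {S : Type*} [Monoid S] {e : Idem S}

theorem single_mem_notUpIdeal {s : S} (h : ¬ JLe e.1 s) :
    MonoidAlgebra.single s 1 ∈ notUpIdeal k e :=
  Submodule.subset_span ⟨s, h, rfl⟩

theorem map_eq_zero_of_mem_notUpIdeal {X : Type*} [AddCommGroup X] [Module k X]
    {f : MonoidAlgebra k S →ₗ[k] X}
    (hf : ∀ s, ¬ JLe e.1 s → f (MonoidAlgebra.single s 1) = 0) {x : MonoidAlgebra k S}
    (hx : x ∈ notUpIdeal k e) : f x = 0 := by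
  refine Submodule.closure_induction (p := fun x _ => f x = 0) (map_zero f)
    (fun x y _ _ hx hy => by rw [map_add, hx, hy, add_zero]) ?_ hx
  rintro a _ ⟨s, hs, rfl⟩
  obtain ⟨a, rfl⟩ := MulOpposite.op_surjective a
  rw [op_smul_eq_mul]
  induction a using MonoidAlgebra.induction_linear with
  | zero => rw [mul_zero, map_zero]
  | add x y hx hy => rw [mul_add, map_add, hx, hy, add_zero]
  | single t c =>
    rw [MonoidAlgebra.single_mul_single, single_eq_smul, map_smul,
      hf _ fun h => hs (h.trans (mul_jLe_left s t)), smul_zero]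

theorem mul_mem_notUpIdeal (a : MonoidAlgebra k S) {x : MonoidAlgebra k S}
    (hx : x ∈ notUpIdeal k e) : a * x ∈ notUpIdeal k e := by
  have hle : notUpIdeal k e ≤ (notUpIdeal k e).comap (Module.toModuleEnd _ _ a) := by
    refine Submodule.span_le.2 ?_
    rintro _ ⟨s, hs, rfl⟩
    change a * MonoidAlgebra.single s 1 ∈ notUpIdeal k e
    induction a using MonoidAlgebra.induction_linear with
    | zero => rw [zero_mul]; exact zero_mem _
    | add a b ha hb => rw [add_mul]; exact add_mem ha hb
    | single t c =>
      rw [MonoidAlgebra.single_mul_single, single_eq_smul]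
      exact Submodule.smul_mem ((notUpIdeal k e).restrictScalars k) _
        (single_mem_notUpIdeal fun h => hs (h.trans (mul_jLe_right t s)))
  exact hle hx

theorem notUpIdeal_mono {e' : Idem S} (h : JLe e.1 e'.1) : notUpIdeal k e ≤ notUpIdeal k e' :=
  Submodule.span_mono fun _ ⟨s, hs, hx⟩ => ⟨s, fun h' => hs (h.trans h'), hx⟩

end NotUpIdeal

section ApexPart

variable (k : Type*) [Field k] {S : Type*} [Monoid S] (e : Idem S)
  (N : Type*) [AddCommGroup N] [Module (MonoidAlgebra k S)ᵐᵒᵖ N]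
  [Module k N] [IsScalarTower k (MonoidAlgebra k S)ᵐᵒᵖ N]

/-- The elements `n` of a right `kS`-module with `ne = n` and `ns = 0` for all `s ≱_J e`. These are
the images of the class of `e` under the homomorphisms from `e(kS/kI)`; as a functor to right
`kG_e`-modules, `apexPart k e` is the right adjoint of `Ind k e`. -/
def apexPart : Submodule k N where
  carrier := {n | rsingle k e.1 • n = n ∧ ∀ s, ¬ JLe e.1 s → rsingle k s • n = 0}
  add_mem' := fun ⟨hm, hm'⟩ ⟨hn, hn'⟩ => ⟨by rw [smul_add, hm, hn],
    fun s hs => by rw [smul_add, hm' s hs, hn' s hs, add_zero]⟩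
  zero_mem' := ⟨smul_zero _, fun _ _ => smul_zero _⟩
  smul_mem' c n := fun ⟨hn, hn'⟩ => ⟨by rw [smul_comm, hn],
    fun s hs => by rw [smul_comm, hn' s hs, smul_zero]⟩

namespace apexPart

variable {k e N} {N' : Type*} [AddCommGroup N'] [Module (MonoidAlgebra k S)ᵐᵒᵖ N']
  [Module k N'] [IsScalarTower k (MonoidAlgebra k S)ᵐᵒᵖ N']

theorem idem_smul (n : apexPart k e N) : rsingle k e.1 • (n : N) = n := n.2.1

theorem smul_eq_zero (n : apexPart k e N) {s : S} (hs : ¬ JLe e.1 s) :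
    rsingle k s • (n : N) = 0 := n.2.2 s hs

theorem op_smul_eq_zero (n : apexPart k e N) {x : MonoidAlgebra k S} (hx : x ∈ notUpIdeal k e) :
    op x • (n : N) = 0 :=
  map_eq_zero_of_mem_notUpIdeal (f := (LinearMap.toSpanSingleton (MonoidAlgebra k S)ᵐᵒᵖ N
    (n : N)).restrictScalars k ∘ₗ (MulOpposite.opLinearEquiv k).toLinearMap)
    (fun _ hs => smul_eq_zero n hs) hx

theorem toS_smul_mem (g : MaxSubgroup e) {n : N} (hn : n ∈ apexPart k e N) :
    rsingle k g.toS • n ∈ apexPart k e N := by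
  refine ⟨by rw [← rsingle_mul_smul, g.toS_mul_idem], fun s hs => ?_⟩
  rw [← rsingle_mul_smul]
  exact hn.2 _ fun h => hs (h.trans (mul_jLe_right _ _))

variable (k e N) in
/-- The right action of `G_e` on `apexPart k e N`. -/
def actionHom : MaxSubgroup e →* (Module.End k (apexPart k e N))ᵐᵒᵖ where
  toFun g := op ((Algebra.lsmul k k N (rsingle k g.toS)).restrict fun _ => toS_smul_mem g)
  map_one' := MulOpposite.unop_injective <| LinearMap.ext fun n => Subtype.ext (idem_smul n)
  map_mul' g h := MulOpposite.unop_injective <| LinearMap.ext fun n => Subtype.ext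
    (rsingle_mul_smul g.toS h.toS (n : N))

instance : Module (MonoidAlgebra k (MaxSubgroup e))ᵐᵒᵖ (apexPart k e N) :=
  Module.compHom _ (AlgHom.opComm (MonoidAlgebra.lift k _ _ (actionHom k e N))).toRingHom

instance : IsScalarTower k (MonoidAlgebra k (MaxSubgroup e))ᵐᵒᵖ (apexPart k e N) where
  smul_assoc c a n := LinearMap.congr_fun
    (map_smul (AlgHom.opComm (MonoidAlgebra.lift k _ _ (actionHom k e N))) c a) n

theorem coe_rsingle_smul (g : MaxSubgroup e) (n : apexPart k e N) :
    ((rsingle k g • n : apexPart k e N) : N) = rsingle k g.toS • (n : N) := by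
  change ((AlgHom.opComm (MonoidAlgebra.lift k _ _ (actionHom k e N)) (rsingle k g) n :
    apexPart k e N) : N) = _
  rw [AlgHom.opComm_apply_apply, MulOpposite.unop_op, MonoidAlgebra.lift_single, one_smul]
  rfl

theorem map_mem (f : N →ₗ[(MonoidAlgebra k S)ᵐᵒᵖ] N') {n : N} (hn : n ∈ apexPart k e N) :
    f n ∈ apexPart k e N' :=
  ⟨by rw [← map_smul, hn.1], fun s hs => by rw [← map_smul, hn.2 s hs, map_zero]⟩

/-- The action of the functor `apexPart k e` on homomorphisms. -/
def map (f : N →ₗ[(MonoidAlgebra k S)ᵐᵒᵖ] N') :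
    apexPart k e N →ₗ[(MonoidAlgebra k (MaxSubgroup e))ᵐᵒᵖ] apexPart k e N' :=
  rightLinear ((f.restrictScalars k).restrict fun _ => map_mem f) fun g n => Subtype.ext <|
    (congrArg f (coe_rsingle_smul g n)).trans <|
      (map_smul f _ _).trans (coe_rsingle_smul g (⟨f n, map_mem f n.2⟩ : apexPart k e N')).symm

theorem coe_map (f : N →ₗ[(MonoidAlgebra k S)ᵐᵒᵖ] N') (n : apexPart k e N) :
    (map f n : N') = f n := rfl

end apexPart

end ApexPart

/-! ### Induced modules -/

section Induced

variable {k : Type*} [Field k] {S : Type*} [Monoid S] (e : Idem S)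

namespace IndBimodule

/-- The map `kS → e(kS/kI)`, `x ↦ ex`. -/
def ofAlgebra : MonoidAlgebra k S →ₗ[(MonoidAlgebra k S)ᵐᵒᵖ] IndBimodule k e :=
  mk k e ∘ₗ (Module.toModuleEnd _ _ (MonoidAlgebra.single e.1 1 : MonoidAlgebra k S)).codRestrict
    (cornerIdeal k e) fun x => mem_cornerIdeal_iff.2 <| by
      rw [Module.toModuleEnd_apply, DistribSMul.toLinearMap_apply, smul_eq_mul, ← mul_assoc,
        MonoidAlgebra.single_mul_single, e.2.eq, mul_one]

theorem ofAlgebra_surjective : Function.Surjective (ofAlgebra (k := k) e) := by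
  intro m
  obtain ⟨x, rfl⟩ := Submodule.Quotient.mk_surjective _ m
  exact ⟨x.1, congrArg (mk k e) (Subtype.ext (mem_cornerIdeal_iff.1 x.2))⟩

theorem ofAlgebra_eq_zero {x : MonoidAlgebra k S} (hx : x ∈ notUpIdeal k e) :
    ofAlgebra e x = 0 :=
  (Submodule.Quotient.mk_eq_zero _).2 (mul_mem_notUpIdeal _ hx)

theorem ofAlgebra_mul_single (x : MonoidAlgebra k S) (s : S) :
    ofAlgebra e (x * MonoidAlgebra.single s 1) = rsingle k s • ofAlgebra e x :=
  map_smul (ofAlgebra e) (rsingle k s) x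

theorem single_smul_ofAlgebra (g : MaxSubgroup e) (c : k) (x : MonoidAlgebra k S) :
    (MonoidAlgebra.single g c : MonoidAlgebra k (MaxSubgroup e)) • ofAlgebra e x =
      c • ofAlgebra e (MonoidAlgebra.single g.toS 1 * x) := by
  change (MonoidAlgebra.lift k (Module.End (MonoidAlgebra k S)ᵐᵒᵖ (IndBimodule k e))
    (MaxSubgroup e) (leftMulHom k e)) (MonoidAlgebra.single g c) _ = _
  rw [MonoidAlgebra.lift_single]
  refine congrArg (c • mk k e ·) (Subtype.ext ?_)
  change MonoidAlgebra.single g.toS 1 * (MonoidAlgebra.single e.1 1 * x) =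
    MonoidAlgebra.single e.1 1 * (MonoidAlgebra.single g.toS 1 * x)
  simp only [← mul_assoc, MonoidAlgebra.single_mul_single, g.toS_mul_idem, g.mul_toS]

instance : SMulCommClass (MonoidAlgebra k (MaxSubgroup e)) (MonoidAlgebra k S)ᵐᵒᵖ
    (IndBimodule k e) where
  smul_comm b := map_smul (MonoidAlgebra.lift k
    (Module.End (MonoidAlgebra k S)ᵐᵒᵖ (IndBimodule k e)) (MaxSubgroup e) (leftMulHom k e) b)

variable {X : Type*} [AddCommGroup X] [Module k X]

/-- The `k`-linear map `e(kS/kI) → X` induced by a map `kS → X` that vanishes on `I`. -/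
def lift (f : MonoidAlgebra k S →ₗ[k] X)
    (hf : ∀ s, ¬ JLe e.1 s → f (MonoidAlgebra.single s 1) = 0) : IndBimodule k e →ₗ[k] X :=
  (((notUpIdeal k e).submoduleOf (cornerIdeal k e)).restrictScalars k).liftQ
    (f ∘ₗ (cornerIdeal k e).subtype.restrictScalars k)
    (fun _ hx => map_eq_zero_of_mem_notUpIdeal hf hx) ∘ₗ
  (Submodule.Quotient.restrictScalarsEquiv k _).symm.toLinearMap

theorem lift_ofAlgebra (f : MonoidAlgebra k S →ₗ[k] X) (hf) (x : MonoidAlgebra k S) :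
    lift e f hf (ofAlgebra e x) = f (MonoidAlgebra.single e.1 1 * x) := rfl

end IndBimodule

namespace BalancedTensor

variable {B A V M X : Type*} [Ring B] [Algebra k B] [Ring A] [Algebra k A]
  [AddCommGroup V] [Module k V] [Module Bᵐᵒᵖ V] [AddCommGroup M] [Module k M] [Module B M]
  [Module Aᵐᵒᵖ M] [IsScalarTower k Aᵐᵒᵖ M] [AddCommGroup X] [Module k X]

variable (k B A V M) in
/-- The bilinear map `(m, v) ↦ v ⊗ m` to `V ⊗_B M`. -/
def mk : M →ₗ[k] V →ₗ[k] BalancedTensor k B A V M :=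
  LinearMap.mk₂ k (fun m v => Submodule.Quotient.mk (m ⊗ₜ[k] v))
    (fun m m' v => by rw [TensorProduct.add_tmul]; rfl)
    (fun c m v => by rw [← TensorProduct.smul_tmul']; rfl)
    (fun m v v' => by rw [TensorProduct.tmul_add]; rfl)
    (fun c m v => by rw [TensorProduct.tmul_smul]; rfl)

theorem op_smul_mk (a : Aᵐᵒᵖ) (m : M) (v : V) :
    a • mk k B A V M m v = mk k B A V M (a • m) v := rfl

theorem smul_mk (b : B) (m : M) (v : V) :
    mk k B A V M (b • m) v = mk k B A V M m (op b • v) :=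
  Eq.symm <| (Submodule.Quotient.eq _).2 <| Submodule.subset_span ⟨v, b, m, rfl⟩

theorem induction_on {motive : BalancedTensor k B A V M → Prop} (x : BalancedTensor k B A V M)
    (zero : motive 0) (add : ∀ x y, motive x → motive y → motive (x + y))
    (mk : ∀ m v, motive (mk k B A V M m v)) : motive x := by
  obtain ⟨z, rfl⟩ := Submodule.Quotient.mk_surjective _ x
  induction z using TensorProduct.induction_on with
  | zero => exact zero
  | add x y hx hy => exact add _ _ hx hy
  | tmul m v => exact mk m v

variable [SMulCommClass B Aᵐᵒᵖ M]

/-- The universal property of the tensor product `V ⊗_B M`. -/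
def lift (L : M →ₗ[k] V →ₗ[k] X) (hL : ∀ (b : B) m v, L (b • m) v = L m (op b • v)) :
    BalancedTensor k B A V M →ₗ[k] X :=
  ((Submodule.span Aᵐᵒᵖ {z : M ⊗[k] V | ∃ (v : V) (b : B) (m : M),
      z = m ⊗ₜ[k] (op b • v) - (b • m) ⊗ₜ[k] v}).restrictScalars k).liftQ (TensorProduct.lift L)
    (fun z hz => by
      refine Submodule.closure_induction (p := fun z _ => TensorProduct.lift L z = 0)
        (map_zero _) (fun x y _ _ hx hy => by rw [map_add, hx, hy, add_zero]) ?_ hz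
      rintro a _ ⟨v, b, m, rfl⟩
      rw [smul_sub, TensorProduct.smul_tmul', TensorProduct.smul_tmul', ← smul_comm b a m, map_sub,
        TensorProduct.lift.tmul, TensorProduct.lift.tmul, hL, sub_self]) ∘ₗ
  (Submodule.Quotient.restrictScalarsEquiv k _).symm.toLinearMap

theorem lift_mk (L : M →ₗ[k] V →ₗ[k] X) (hL) (m : M) (v : V) :
    lift (B := B) (A := A) L hL (mk k B A V M m v) = L m v := rfl

end BalancedTensor

namespace Ind

variable {V : Type*} [AddCommGroup V] [Module k V] [Module (MonoidAlgebra k (MaxSubgroup e))ᵐᵒᵖ V]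

/-- The map `v ↦ v ⊗ es` from `V` to `Ind_e(V)`. -/
def tmk (s : S) : V →ₗ[k] Ind k e V :=
  BalancedTensor.mk k _ _ V (IndBimodule k e) (IndBimodule.ofAlgebra e (MonoidAlgebra.single s 1))

theorem rsingle_smul_tmk (s t : S) (v : V) :
    rsingle k t • tmk (k := k) e s v = tmk e (s * t) v := by
  rw [tmk, tmk, BalancedTensor.op_smul_mk, ← IndBimodule.ofAlgebra_mul_single,
    MonoidAlgebra.single_mul_single, mul_one]

variable {e} in
theorem tmk_of_not_jLe {s : S} (h : ¬ JLe e.1 s) : tmk (k := k) (V := V) e s = 0 := by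
  rw [tmk, IndBimodule.ofAlgebra_eq_zero e (single_mem_notUpIdeal h), map_zero]

theorem tmk_toS_mul (g : MaxSubgroup e) (s : S) (v : V) :
    tmk (k := k) e (g.toS * s) v = tmk e s (rsingle k g • v) := by
  rw [tmk, tmk, ← BalancedTensor.smul_mk, IndBimodule.single_smul_ofAlgebra, one_smul,
    MonoidAlgebra.single_mul_single, mul_one]

theorem tmk_idem_mul (s : S) (v : V) : tmk (k := k) e (e.1 * s) v = tmk e s v :=
  (tmk_toS_mul e 1 s v).trans (by rw [rsingle_one_smul])

variable {e} in
theorem induction_on {motive : Ind k e V → Prop} (x : Ind k e V)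
    (add : ∀ x y, motive x → motive y → motive (x + y))
    (tmk : ∀ s v, motive (tmk (k := k) e s v)) : motive x := by
  have zero : motive 0 := map_zero (Ind.tmk (k := k) (V := V) e e.1) ▸ tmk e.1 0
  induction x using BalancedTensor.induction_on with
  | zero => exact zero
  | add x y hx hy => exact add _ _ hx hy
  | mk m v =>
    obtain ⟨y, rfl⟩ := IndBimodule.ofAlgebra_surjective e m
    induction y using MonoidAlgebra.induction_linear with
    | zero => rw [map_zero, map_zero]; exact zero
    | add x y hx hy => rw [map_add, map_add]; exact add _ _ hx hy
    | single s c =>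
      rw [single_eq_smul, LinearMap.map_smul_of_tower, map_smul, LinearMap.smul_apply, ← map_smul]
      exact tmk s (c • v)

theorem hom_ext {F X : Type*} [AddCommGroup X] [FunLike F (Ind k e V) X]
    [AddMonoidHomClass F (Ind k e V) X] {f g : F}
    (h : ∀ s v, f (tmk e s v) = g (tmk e s v)) : f = g :=
  DFunLike.ext f g fun x => induction_on (motive := fun x => f x = g x) x
    (fun x y hx hy => by rw [map_add, map_add, hx, hy]) h

variable {e} in
theorem rsingle_smul_eq_zero {s : S} (hs : ¬ JLe e.1 s) (x : Ind k e V) : rsingle k s • x = 0 := by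
  induction x using induction_on with
  | add x y hx hy => rw [smul_add, hx, hy, add_zero]
  | tmk t v =>
    rw [rsingle_smul_tmk, tmk_of_not_jLe fun h => hs (h.trans (mul_jLe_right _ _)),
      LinearMap.zero_apply]

variable [IsScalarTower k (MonoidAlgebra k (MaxSubgroup e))ᵐᵒᵖ V]
  {X : Type*} [AddCommGroup X] [Module k X] {e}

theorem lift_balanced {f : MonoidAlgebra k S →ₗ[k] V →ₗ[k] X} (hf)
    (hg : ∀ (g : MaxSubgroup e) s v, f (MonoidAlgebra.single (g.toS * s) 1) v =
      f (MonoidAlgebra.single s 1) (rsingle k g • v))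
    (b : MonoidAlgebra k (MaxSubgroup e)) (m : IndBimodule k e) (v : V) :
    IndBimodule.lift e f hf (b • m) v = IndBimodule.lift e f hf m (op b • v) := by
  obtain ⟨x, rfl⟩ := IndBimodule.ofAlgebra_surjective e m
  induction x using MonoidAlgebra.induction_linear with
  | zero => simp only [map_zero, smul_zero, LinearMap.zero_apply]
  | add x y hx hy => rw [map_add, smul_add, map_add, map_add, LinearMap.add_apply, hx, hy,
      LinearMap.add_apply]
  | single s c =>
    induction b using MonoidAlgebra.induction_linear with
    | zero => simp only [zero_smul, map_zero, LinearMap.zero_apply, MulOpposite.op_zero]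
    | add a b ha hb =>
      rw [add_smul, map_add, LinearMap.add_apply, ha, hb, MulOpposite.op_add, add_smul, map_add]
    | single g d =>
      rw [IndBimodule.single_smul_ofAlgebra, op_single_smul, map_smul, map_smul,
        IndBimodule.lift_ofAlgebra, IndBimodule.lift_ofAlgebra, single_eq_smul s c]
      simp only [mul_smul_comm, map_smul, LinearMap.smul_apply, MonoidAlgebra.single_mul_single,
        one_mul, ← mul_assoc, g.mul_toS, hg]
      rw [← MaxSubgroup.toS_one, hg, rsingle_one_smul]

/-- The `k`-linear map from `Ind_e(V)` with prescribed values on the generators `v ⊗ es`. -/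
def lift (β : S → V →ₗ[k] X) (h0 : ∀ s, ¬ JLe e.1 s → β s = 0)
    (hg : ∀ (g : MaxSubgroup e) s v, β (g.toS * s) v = β s (rsingle k g • v)) :
    Ind k e V →ₗ[k] X :=
  BalancedTensor.lift
    (IndBimodule.lift e ((MonoidAlgebra.basis S k).constr k β) fun s hs => by
      rw [← MonoidAlgebra.basis_apply, Module.Basis.constr_basis, h0 s hs])
    (lift_balanced _ fun g s v => by
      rw [← MonoidAlgebra.basis_apply, ← MonoidAlgebra.basis_apply, Module.Basis.constr_basis,
        Module.Basis.constr_basis, hg])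

theorem lift_tmk (β : S → V →ₗ[k] X) (h0) (hg) (s : S) (v : V) :
    lift β h0 hg (tmk e s v) = β s v := by
  rw [lift, tmk, BalancedTensor.lift_mk, IndBimodule.lift_ofAlgebra,
    MonoidAlgebra.single_mul_single, one_mul, ← MonoidAlgebra.basis_apply,
    Module.Basis.constr_basis, ← MaxSubgroup.toS_one, hg, rsingle_one_smul]

end Ind

end Induced

section Adjunction

variable {k : Type*} [Field k] {S : Type*} [Monoid S] {e : Idem S}
  {V : Type*} [AddCommGroup V] [Module k V] [Module (MonoidAlgebra k (MaxSubgroup e))ᵐᵒᵖ V]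
  {N : Type*} [AddCommGroup N] [Module (MonoidAlgebra k S)ᵐᵒᵖ N] [Module k N]
  [IsScalarTower k (MonoidAlgebra k S)ᵐᵒᵖ N]

namespace Ind

theorem tmk_idem_mem_apexPart (v : V) : tmk (k := k) e e.1 v ∈ apexPart k e (Ind k e V) := by
  refine ⟨by rw [rsingle_smul_tmk, e.2.eq], fun s hs => ?_⟩
  rw [rsingle_smul_tmk, tmk_of_not_jLe fun h => hs (h.trans (mul_jLe_right _ _)),
    LinearMap.zero_apply]

variable [IsScalarTower k (MonoidAlgebra k (MaxSubgroup e))ᵐᵒᵖ V]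

variable (k e V) in
/-- The map `v ↦ v ⊗ e`, the unit of the adjunction between `Ind k e` and `apexPart k e`. -/
def unit : V →ₗ[(MonoidAlgebra k (MaxSubgroup e))ᵐᵒᵖ] apexPart k e (Ind k e V) :=
  rightLinear ((tmk e e.1).codRestrict _ tmk_idem_mem_apexPart) fun g v => Subtype.ext <| by
    rw [apexPart.coe_rsingle_smul, LinearMap.codRestrict_apply, LinearMap.codRestrict_apply,
      rsingle_smul_tmk, ← tmk_toS_mul, g.toS_mul_idem, g.mul_toS]

theorem coe_unit (v : V) : (unit k e V v : Ind k e V) = tmk e e.1 v := rfl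

theorem rsingle_smul_unit (s : S) (v : V) :
    rsingle k s • (unit k e V v : Ind k e V) = tmk e s v := by
  rw [coe_unit, rsingle_smul_tmk, tmk_idem_mul]

/-- The homomorphism `v ⊗ es ↦ φ(v)s` that corresponds to `φ` under `Ind.homEquiv`. -/
def ofHom (φ : V →ₗ[(MonoidAlgebra k (MaxSubgroup e))ᵐᵒᵖ] apexPart k e N) :
    Ind k e V →ₗ[(MonoidAlgebra k S)ᵐᵒᵖ] N :=
  rightLinear
    (lift (fun s => Algebra.lsmul k k N (rsingle k s) ∘ₗ (apexPart k e N).subtype ∘ₗ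
        φ.restrictScalars k)
      (fun s hs => LinearMap.ext fun v => apexPart.smul_eq_zero (φ v) hs)
      fun g s v => by
        change rsingle k (g.toS * s) • (φ v : N) = rsingle k s • (φ (rsingle k g • v) : N)
        rw [rsingle_mul_smul, map_smul, apexPart.coe_rsingle_smul])
    fun t x => by
      induction x using induction_on with
      | add x y hx hy => rw [smul_add, map_add, map_add, smul_add, hx, hy]
      | tmk s v =>
        rw [rsingle_smul_tmk, lift_tmk, lift_tmk]
        exact rsingle_mul_smul s t (φ v : N)

theorem ofHom_tmk (φ : V →ₗ[(MonoidAlgebra k (MaxSubgroup e))ᵐᵒᵖ] apexPart k e N) (s : S)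
    (v : V) : ofHom φ (tmk e s v) = rsingle k s • (φ v : N) := by
  rw [ofHom, rightLinear_apply, lift_tmk]
  rfl

variable (e V N) in
/-- Frobenius reciprocity: `Ind k e` is left adjoint to `apexPart k e`. -/
def homEquiv : (Ind k e V →ₗ[(MonoidAlgebra k S)ᵐᵒᵖ] N) ≃ₗ[k]
    (V →ₗ[(MonoidAlgebra k (MaxSubgroup e))ᵐᵒᵖ] apexPart k e N) where
  toFun F := apexPart.map F ∘ₗ unit k e V
  invFun := ofHom
  map_add' _ _ := rfl
  map_smul' _ _ := rfl
  left_inv F := hom_ext e fun s v => by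
    rw [ofHom_tmk, LinearMap.comp_apply, apexPart.coe_map, ← map_smul, rsingle_smul_unit]
  right_inv φ := LinearMap.ext fun v => Subtype.ext <|
    (ofHom_tmk φ e.1 v).trans (apexPart.idem_smul (φ v))

end Ind

end Adjunction

/-! ### The trace on an induced module -/

section Trace

theorem trace_eq_sum_trace {k ι M W : Type*} [Field k] [Fintype ι] [AddCommGroup M] [Module k M]
    [FiniteDimensional k M] [AddCommGroup W] [Module k W] [FiniteDimensional k W]
    {p : ι → W →ₗ[k] M} {q : ι → M →ₗ[k] W} (h : ∀ x, ∑ i, p i (q i x) = x)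
    (T : M →ₗ[k] M) : LinearMap.trace k M T = ∑ i, LinearMap.trace k W (q i ∘ₗ T ∘ₗ p i) := by
  calc LinearMap.trace k M T = LinearMap.trace k M (∑ i, (T ∘ₗ p i) ∘ₗ q i) := by
        refine congrArg _ (LinearMap.ext fun x => ?_)
        rw [LinearMap.sum_apply, ← congrArg T (h x), map_sum]
        rfl
    _ = ∑ i, LinearMap.trace k W (q i ∘ₗ T ∘ₗ p i) := by
        simp only [map_sum, LinearMap.trace_comp_comm' _ (q _)]

end Trace

section Components

variable {k : Type*} [Field k] {S : Type*} [Monoid S] {e : Idem S}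
  {W : Type*} [AddCommGroup W] [Module k W] [Module (MonoidAlgebra k (MaxSubgroup e))ᵐᵒᵖ W]

namespace Ind

theorem tmk_toMaxSubgroup_smul [Finite S] (hS : IsRightRegularBandOfGroups S) {s : S}
    (hs : JLe e.1 s) (t : S) (w : W) :
    tmk (k := k) e t (rsingle k (toMaxSubgroup e s) • w) = tmk e (s * (e.1 * t)) w := by
  rw [← tmk_toS_mul, hS.toS_toMaxSubgroup hs, mul_assoc]

variable [IsScalarTower k (MonoidAlgebra k (MaxSubgroup e))ᵐᵒᵖ W]

section Finite

variable [Finite S]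

open Classical in
/-- Since `w ⊗ es = wg ⊗ f` for `f = (es)^ω` and `g = ese`, the module `Ind_e(W)` is the direct sum
of the subspaces `W ⊗ f` over the idempotents `f` in the `J`-class of `e`. This is the projection
onto the summand of `f`, identified with `W`. -/
def component (hS : IsRightRegularBandOfGroups S) (f : S) : Ind k e W →ₗ[k] W :=
  lift (fun s => if JLe e.1 s ∧ omegaPow (e.1 * s) = f then
      Algebra.lsmul k k W (rsingle k (toMaxSubgroup e s)) else 0)
    (fun _ hs => if_neg fun h => hs h.1)
    fun g s w => by
      by_cases hs : JLe e.1 s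
      · have hω : omegaPow (e.1 * (g.toS * s)) = omegaPow (e.1 * s) := by
          rw [← mul_assoc, g.mul_toS, ← g.toS_mul_idem, mul_assoc]
          refine hS.omegaPow_mul (g.jEquiv_toS.symm.trans ?_)
          exact jEquiv_iff.2 ⟨hS.jLe_mul_iff.2 ⟨JLe.refl _, hs⟩, mul_jLe_left _ _⟩
        have hgs : JLe e.1 (g.toS * s) := hS.jLe_mul_iff.2 ⟨g.jEquiv_toS.le, hs⟩
        rw [hω, hS.toMaxSubgroup_mul g.jEquiv_toS.le hs, hS.toMaxSubgroup_toS]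
        simp only [hs, hgs, true_and]
        split_ifs
        · exact rsingle_mul_smul g _ w
        · rfl
      · rw [if_neg fun h => hs (h.1.trans (mul_jLe_right _ _)), if_neg fun h => hs h.1,
          LinearMap.zero_apply, LinearMap.zero_apply]

open Classical in
theorem component_tmk (hS : IsRightRegularBandOfGroups S) (f s : S) (w : W) :
    component hS f (tmk (k := k) e s w) = if JLe e.1 s ∧ omegaPow (e.1 * s) = f then
      rsingle k (toMaxSubgroup e s) • w else 0 := by
  rw [component, lift_tmk]
  split_ifs <;> rfl

theorem component_tmk_idem (hS : IsRightRegularBandOfGroups S) (w : W) :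
    component hS e.1 (tmk (k := k) e e.1 w) = w := by
  have hω : omegaPow (e.1 * e.1) = e.1 :=
    (omegaPow_eq_iff _ _).2 ⟨e.2, 1, one_pos, by rw [pow_one, e.2.eq]⟩
  rw [component_tmk, if_pos ⟨JLe.refl _, hω⟩, hS.toMaxSubgroup_eq_one e.2 rfl, rsingle_one_smul]

theorem unit_bijective (hS : IsRightRegularBandOfGroups S) :
    Function.Bijective (unit k e W) := by
  refine ⟨fun v w h => ?_, fun n => ?_⟩
  · rw [← component_tmk_idem (k := k) (e := e) hS v, ← component_tmk_idem (k := k) (e := e) hS w]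
    exact congrArg _ (congrArg Subtype.val h)
  · suffices ∀ x : Ind k e W, ∃ w, tmk e e.1 w = rsingle k e.1 • x by
      obtain ⟨w, hw⟩ := this n
      exact ⟨w, Subtype.ext (hw.trans (apexPart.idem_smul n))⟩
    intro x
    induction x using induction_on with
    | add x y hx hy =>
      obtain ⟨⟨v, hv⟩, w, hw⟩ := And.intro hx hy
      exact ⟨v + w, by rw [map_add, hv, hw, smul_add]⟩
    | tmk s w =>
      rw [rsingle_smul_tmk]
      by_cases hs : JLe e.1 s
      · exact ⟨_, (tmk_toMaxSubgroup_smul hS hs e.1 w).trans (by rw [e.2.eq])⟩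
      · refine ⟨0, ?_⟩
        rw [map_zero, tmk_of_not_jLe fun h => hs (h.trans (mul_jLe_left _ _)),
          LinearMap.zero_apply]

/-- The unit of the adjunction between `Ind k e` and `apexPart k e` as an isomorphism. -/
def unitEquiv (hS : IsRightRegularBandOfGroups S) :
    W ≃ₗ[(MonoidAlgebra k (MaxSubgroup e))ᵐᵒᵖ] apexPart k e (Ind k e W) :=
  LinearEquiv.ofBijective (unit k e W) (unit_bijective hS)

end Finite

theorem sum_tmk_component [Fintype S] (hS : IsRightRegularBandOfGroups S) (x : Ind k e W) :
    ∑ f : S, tmk e f (component hS f x) = x := by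
  classical
  induction x using induction_on with
  | add x y hx hy => simp only [map_add, Finset.sum_add_distrib, hx, hy]
  | tmk s w =>
    simp only [component_tmk, apply_ite, map_zero]
    by_cases hs : JLe e.1 s
    · have hf : e.1 * omegaPow (e.1 * s) = omegaPow (e.1 * s) :=
        (hS.jLe_idem_iff e.2).1 ((hS.omegaPow_jEquiv _).le.trans (mul_jLe_left _ _))
      simp only [hs, true_and, Finset.sum_ite_eq, Finset.mem_univ, if_true]
      rw [tmk_toMaxSubgroup_smul hS hs, hf, ← tmk_idem_mul, ← mul_assoc, hS.mul_omegaPow,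
        tmk_idem_mul]
    · simp only [hs, false_and, if_false, Finset.sum_const_zero, tmk_of_not_jLe hs,
        LinearMap.zero_apply]

variable [FiniteDimensional k W]

theorem finiteDimensional [Finite S] (hS : IsRightRegularBandOfGroups S) :
    FiniteDimensional k (Ind k e W) := by
  classical
  cases nonempty_fintype S
  refine Module.Finite.of_surjective
    (LinearMap.lsum k (fun _ : S => W) k fun f => tmk (k := k) e f) fun x => ?_
  refine ⟨fun f => component hS f x, ?_⟩
  rw [LinearMap.lsum_apply, LinearMap.sum_apply]
  exact sum_tmk_component hS x

open Classical in
theorem actionTrace_ind [Fintype S] (hS : IsRightRegularBandOfGroups S) (s : S) :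
    actionTrace k (Ind k e W) (MonoidAlgebra.single s 1) =
      ∑ f : S with IsIdempotentElem f ∧ JEquiv f e.1 ∧ omegaPow (f * s) = f,
        character k e W (toMaxSubgroup e (f * s)) := by
  have := finiteDimensional (k := k) (e := e) (W := W) hS
  have hcomp (f : S) : component hS f ∘ₗ Algebra.lsmul k k (Ind k e W) (rsingle k s) ∘ₗ
      tmk (k := k) (V := W) e f =
      if IsIdempotentElem f ∧ JEquiv f e.1 ∧ omegaPow (f * s) = f then
        Algebra.lsmul k k W (rsingle k (toMaxSubgroup e (f * s))) else 0 := by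
    refine LinearMap.ext fun w => ?_
    change component hS f (rsingle k s • tmk (k := k) e f w) = _
    rw [rsingle_smul_tmk, component_tmk, if_congr hS.omegaPow_idem_mul_eq_iff rfl rfl]
    split_ifs <;> rfl
  rw [actionTrace_apply, trace_eq_sum_trace (sum_tmk_component hS), Finset.sum_filter]
  refine Finset.sum_congr rfl fun f _ => ?_
  rw [hcomp, apply_ite (LinearMap.trace k W), map_zero, character]

end Ind

end Components

/-! ### Splitting the projections `kS → kS/kI` -/

section Splitting

variable {k : Type*} [Field k] {S : Type*} [Monoid S]

/-- An element `η` of `kS` with `ηe = η` and `ηI = 0` that represents the class of `e` in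
`e(kS/kI)`; right multiplication by `η` then projects every right `kS`-module onto its
`apexPart k e`. -/
structure IsSplitting (e : Idem S) (η : MonoidAlgebra k S) : Prop where
  mem_apexPart : η ∈ apexPart k e (MonoidAlgebra k S)
  sub_mem : η - MonoidAlgebra.single e.1 1 ∈ notUpIdeal k e

namespace IsSplitting

variable {e : Idem S} {η : MonoidAlgebra k S} (hη : IsSplitting e η)
include hη

theorem mul_idem : η * MonoidAlgebra.single e.1 1 = η := hη.mem_apexPart.1

theorem mul_single {s : S} (hs : ¬ JLe e.1 s) : η * MonoidAlgebra.single s 1 = 0 :=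
  hη.mem_apexPart.2 s hs

theorem mul_eq_zero {x : MonoidAlgebra k S} (hx : x ∈ notUpIdeal k e) : η * x = 0 :=
  apexPart.op_smul_eq_zero ⟨η, hη.mem_apexPart⟩ hx

theorem mul_mul_self (x : MonoidAlgebra k S) : η * x * η = η * x * MonoidAlgebra.single e.1 1 := by
  have h : η * (x * (η - MonoidAlgebra.single e.1 1)) = 0 :=
    hη.mul_eq_zero (mul_mem_notUpIdeal x hη.sub_mem)
  rwa [← mul_assoc, mul_sub, sub_eq_zero] at h

theorem mul_self : η * η = η := by
  simpa only [mul_one, hη.mul_idem] using hη.mul_mul_self 1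

theorem smul_mem {N : Type*} [AddCommGroup N] [Module (MonoidAlgebra k S)ᵐᵒᵖ N] [Module k N]
    [IsScalarTower k (MonoidAlgebra k S)ᵐᵒᵖ N] (n : N) : op η • n ∈ apexPart k e N :=
  ⟨by rw [← mul_smul, ← MulOpposite.op_mul, hη.mul_idem],
    fun s hs => by rw [← mul_smul, ← MulOpposite.op_mul, hη.mul_single hs, MulOpposite.op_zero,
      zero_smul]⟩

theorem smul_eq_self {N : Type*} [AddCommGroup N] [Module (MonoidAlgebra k S)ᵐᵒᵖ N] [Module k N]
    [IsScalarTower k (MonoidAlgebra k S)ᵐᵒᵖ N] (n : apexPart k e N) : op η • (n : N) = n := by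
  have h := apexPart.op_smul_eq_zero n hη.sub_mem
  rwa [MulOpposite.op_sub, sub_smul, sub_eq_zero, apexPart.idem_smul] at h

theorem trace_mul_idem (hS : IsRightRegularBandOfGroups S) {τ : MonoidAlgebra k S → k}
    (hτ : ∀ x y, τ (x * y) = τ (y * x)) (x : MonoidAlgebra k S) {t : S}
    (ht : IsIdempotentElem t) (h : JLe e.1 t) :
    τ (η * x * MonoidAlgebra.single t 1) = τ (η * x) := by
  have corner (y : MonoidAlgebra k S) : τ (η * y) = τ (η * y * MonoidAlgebra.single e.1 1) := by
    rw [← hη.mul_mul_self, hτ (η * y), ← mul_assoc, hη.mul_self]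
  rw [mul_assoc, corner, ← mul_assoc, mul_assoc, MonoidAlgebra.single_mul_single, one_mul,
    (hS.jLe_idem_iff ht).1 h, ← corner]

end IsSplitting

variable {n : ℕ} (e : Fin n → Idem S)

theorem wellFounded_jLt : WellFounded fun i j => JLt (e i).1 (e j).1 :=
  have : IsTrans (Fin n) fun i j => JLt (e i).1 (e j).1 :=
    ⟨fun _ _ _ h h' => ⟨h.1.trans h'.1, fun h'' => h.2 (h'.1.trans h'')⟩⟩
  have : Std.Irrefl fun i j => JLt (e i).1 (e j).1 := ⟨fun _ h => h.2 h.1⟩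
  Finite.wellFounded_of_trans_of_irrefl _

open Classical in
variable (k) in
/-- The solution of the recursion `η_j = (1 - ∑_{i < j} η_i) e_j` along the `J`-order. -/
def splitting : Fin n → MonoidAlgebra k S :=
  (wellFounded_jLt e).fix fun j η =>
    (1 - ∑ i : {i // JLt (e i).1 (e j).1}, η i i.2) * MonoidAlgebra.single (e j).1 1

open Classical in
theorem splitting_eq (j : Fin n) : splitting k e j =
    (1 - ∑ i with JLt (e i).1 (e j).1, splitting k e i) * MonoidAlgebra.single (e j).1 1 := by
  rw [splitting, WellFounded.fix_eq, ← Finset.sum_subtype_eq_sum_filter]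
  simp only [Finset.subtype_univ]

theorem splitting_mul_idem (j : Fin n) :
    splitting k e j * MonoidAlgebra.single (e j).1 1 = splitting k e j := by
  rw [splitting_eq, mul_assoc, MonoidAlgebra.single_mul_single, (e j).2.eq, one_mul]

variable {e} (he : IsJTransversal e)
include he

theorem IsJTransversal.eq_of_jEquiv {i j : Fin n} (h : JEquiv (e i).1 (e j).1) : i = j :=
  (he (e i).1).unique rfl h

theorem IsJTransversal.jLe_iff {i j : Fin n} :
    JLe (e i).1 (e j).1 ↔ i = j ∨ JLt (e i).1 (e j).1 := by
  refine ⟨fun h => or_iff_not_imp_right.2 fun h' => ?_, ?_⟩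
  · exact he.eq_of_jEquiv (jEquiv_iff.2 ⟨h, not_not.1 fun h'' => h' ⟨h, h''⟩⟩)
  · rintro (rfl | h)
    exacts [JLe.refl _, h.1]

open Classical in
theorem sum_splitting_mul_idem (m : Fin n) :
    (∑ i with JLe (e i).1 (e m).1, splitting k e i) * MonoidAlgebra.single (e m).1 1 =
      MonoidAlgebra.single (e m).1 1 := by
  have hsplit : ∑ i with JLe (e i).1 (e m).1, splitting k e i =
      splitting k e m + ∑ i with JLt (e i).1 (e m).1, splitting k e i := by
    rw [← Finset.sum_insert fun h => (Finset.mem_filter.1 h).2.2 (JLe.refl _)]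
    refine Finset.sum_congr (Finset.ext fun i => ?_) fun _ _ => rfl
    simp only [Finset.mem_filter, Finset.mem_univ, true_and, Finset.mem_insert, he.jLe_iff]
  rw [hsplit, add_mul, splitting_mul_idem, splitting_eq, ← add_mul, sub_add_cancel, one_mul]

variable (hS : IsRightRegularBandOfGroups S)
include hS

theorem splitting_mul_single_eq_zero {j : Fin n}
    (ih : ∀ i, JLt (e i).1 (e j).1 → IsSplitting (e i) (splitting k e i)) {s : S}
    (hs : ¬ JLe (e j).1 s) : splitting k e j * MonoidAlgebra.single s 1 = 0 := by
  classical
  obtain ⟨m, hm, -⟩ := he ((e j).1 * s)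
  have hmj : JLt (e m).1 (e j).1 := ⟨hm.ge.trans (mul_jLe_left _ _),
    fun h => hs ((h.trans hm.ge).trans (mul_jLe_right _ _))⟩
  have hsum : (∑ i with JLt (e i).1 (e j).1, splitting k e i) * MonoidAlgebra.single (e m).1 1 =
      MonoidAlgebra.single (e m).1 1 := by
    refine .trans ?_ (sum_splitting_mul_idem he m)
    rw [Finset.sum_mul, Finset.sum_mul]
    refine (Finset.sum_subset (fun i hi => ?_) fun i hi hi' => ?_).symm
    all_goals simp only [Finset.mem_filter, Finset.mem_univ, true_and] at hi ⊢
    · exact ⟨hi.trans hmj.1, fun h => hmj.2 (h.trans hi)⟩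
    · exact (ih i hi).mul_single fun h => hi' (Finset.mem_filter.2 ⟨Finset.mem_univ _, h⟩)
  rw [splitting_eq, mul_assoc, MonoidAlgebra.single_mul_single, one_mul,
    ← (hS.jLe_idem_iff (e m).2).1 hm.le, ← one_mul (1 : k), ← MonoidAlgebra.single_mul_single,
    ← mul_assoc, sub_mul, one_mul, hsum, sub_self, zero_mul]

theorem isSplitting_splitting (j : Fin n) : IsSplitting (e j) (splitting k e j) := by
  classical
  induction j using (wellFounded_jLt e).induction with
  | _ j ih =>
    refine ⟨⟨splitting_mul_idem e j, fun s hs => splitting_mul_single_eq_zero he hS ih hs⟩, ?_⟩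
    have hlow (i) (hi : JLt (e i).1 (e j).1) : splitting k e i ∈ notUpIdeal k (e j) := by
      rw [← sub_add_cancel (splitting k e i) (MonoidAlgebra.single (e i).1 1)]
      exact add_mem (notUpIdeal_mono hi.1 (ih i hi).sub_mem) (single_mem_notUpIdeal hi.2)
    rw [splitting_eq, sub_mul, one_mul, sub_sub_cancel_left]
    exact neg_mem <| Submodule.smul_mem _ (rsingle k (e j).1) <| sum_mem fun i hi =>
      hlow i (Finset.mem_filter.1 hi).2

theorem sum_splitting : ∑ i, splitting k e i = 1 := by
  classical
  obtain ⟨t, ht, -⟩ := he 1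
  have het : (e t).1 = 1 := by simpa only [mul_one] using (hS.jLe_idem_iff (e t).2).1 ht.le
  have hle (i) : JLe (e i).1 (e t).1 := by
    rw [het]
    simpa only [mul_one] using mul_jLe_right (e i).1 1
  have h := sum_splitting_mul_idem (k := k) he t
  rwa [Finset.filter_true_of_mem fun i _ => hle i, het, ← MonoidAlgebra.one_def, mul_one] at h

open Classical in
theorem trace_mul_idem_eq_sum {τ : MonoidAlgebra k S →ₗ[k] k}
    (hτ : ∀ x y, τ (x * y) = τ (y * x)) (x : MonoidAlgebra k S) (m : Fin n) :
    τ (x * MonoidAlgebra.single (e m).1 1) =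
      ∑ j with JLe (e j).1 (e m).1, τ (splitting k e j * x) := by
  calc τ (x * MonoidAlgebra.single (e m).1 1)
      = ∑ j, τ (splitting k e j * x * MonoidAlgebra.single (e m).1 1) := by
        simp only [← map_sum, ← Finset.sum_mul, sum_splitting he hS, one_mul]
    _ = ∑ j with JLe (e j).1 (e m).1, τ (splitting k e j * x) := by
        rw [Finset.sum_filter]
        refine Finset.sum_congr rfl fun j _ => ?_
        have hj := isSplitting_splitting (k := k) he hS j
        split_ifs with h
        · exact hj.trace_mul_idem hS hτ x (e m).2 h
        · rw [mul_assoc, hj.mul_eq_zero (mul_mem_notUpIdeal x (single_mem_notUpIdeal h)), map_zero]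

end Splitting

/-! ### Möbius inversion over the `J`-classes -/

section Moebius

variable {S : Type*} [Monoid S] (hS : IsRightRegularBandOfGroups S) {n : ℕ}
  {e : Fin n → Idem S} (he : IsJTransversal e)
include hS

theorem principal_le_principal_iff {s t : S} : principal s ≤ principal t ↔ JLe s t := by
  rw [JLe, ← hS.rightIdeal_eq_twoSidedIdeal, ← hS.rightIdeal_eq_twoSidedIdeal]
  rfl

include he

theorem principal_bijective : Function.Bijective fun m => principal (e m).1 := by
  refine ⟨fun i j h => he.eq_of_jEquiv <| jEquiv_iff.2
    ⟨(principal_le_principal_iff hS).1 h.le, (principal_le_principal_iff hS).1 h.ge⟩, ?_⟩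
  rintro ⟨_, s, rfl⟩
  obtain ⟨m, hm, -⟩ := he s
  exact ⟨m, le_antisymm ((principal_le_principal_iff hS).2 hm.ge)
    ((principal_le_principal_iff hS).2 hm.le)⟩

variable [Finite S]

open Classical in
theorem sum_moebius (j i : Fin n) :
    ∑ m with JLe (e j).1 (e m).1 ∧ JLe (e m).1 (e i).1, moebius (e m).1 (e i).1 =
      if j = i then 1 else 0 := by
  let : Fintype (PrincipalRightIdeals S) := Fintype.ofFinite _
  let : LocallyFiniteOrder (PrincipalRightIdeals S) := Fintype.toLocallyFiniteOrder
  have hb := principal_bijective hS he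
  rw [← if_congr hb.injective.eq_iff rfl rfl, ← IncidenceAlgebra.sum_Icc_mu_left]
  refine Finset.sum_bijective _ hb (fun m => ?_) fun m _ => rfl
  simp only [Finset.mem_filter, Finset.mem_univ, true_and, Finset.mem_Icc,
    principal_le_principal_iff hS]

open Classical in
theorem moebius_inversion {R : Type*} [Ring R] {f g : Fin n → R}
    (h : ∀ m, f m = ∑ j with JLe (e j).1 (e m).1, g j) (i : Fin n) :
    g i = ∑ m with JLe (e m).1 (e i).1, (moebius (e m).1 (e i).1 : R) * f m := by
  symm
  calc ∑ m with JLe (e m).1 (e i).1, (moebius (e m).1 (e i).1 : R) * f m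
      = ∑ j, ∑ m with JLe (e j).1 (e m).1 ∧ JLe (e m).1 (e i).1,
          (moebius (e m).1 (e i).1 : R) * g j := by
        simp only [h, Finset.mul_sum]
        exact Finset.sum_comm' fun m j => by
          simp only [Finset.mem_filter, Finset.mem_univ, true_and, and_comm]
    _ = ∑ j, if j = i then g j else 0 := by
        simp only [← Finset.sum_mul, ← Int.cast_sum, sum_moebius hS he, Int.cast_ite, Int.cast_one,
          Int.cast_zero, ite_mul, one_mul, zero_mul]
    _ = g i := Fintype.sum_ite_eq' i g

open Classical in
theorem trace_splitting_mul {k : Type*} [Field k] {τ : MonoidAlgebra k S →ₗ[k] k}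
    (hτ : ∀ x y, τ (x * y) = τ (y * x)) (x : MonoidAlgebra k S) (i : Fin n) :
    τ (splitting k e i * x) = ∑ m with JLe (e m).1 (e i).1,
      (moebius (e m).1 (e i).1 : k) * τ (x * MonoidAlgebra.single (e m).1 1) :=
  moebius_inversion hS he (g := fun j => τ (splitting k e j * x))
    (fun m => trace_mul_idem_eq_sum he hS hτ x m) i

end Moebius

section GroupModules

variable {k : Type*} [Field k] {G : Type*} [Group G]
  {V : Type*} [AddCommGroup V] [Module k V] [Module (MonoidAlgebra k G)ᵐᵒᵖ V]
  [IsScalarTower k (MonoidAlgebra k G)ᵐᵒᵖ V]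
  {U : Type*} [AddCommGroup U] [Module k U] [Module (MonoidAlgebra k G)ᵐᵒᵖ U]
  [IsScalarTower k (MonoidAlgebra k G)ᵐᵒᵖ U]

variable (k G V) in
/-- A right `kG`-module as a representation of `G`, with `g` acting as `v ↦ v · g⁻¹`. -/
def rightRepresentation : Representation k G V where
  toFun g := Algebra.lsmul k k V (rsingle k g⁻¹)
  map_one' := LinearMap.ext fun v => by
    rw [inv_one]
    exact rsingle_one_smul v
  map_mul' g h := LinearMap.ext fun v => by
    rw [mul_inv_rev]
    exact rsingle_mul_smul h⁻¹ g⁻¹ v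

/-- Homomorphisms of right `kG`-modules are the intertwining maps of the representations. -/
def homEquivIntertwiningMap : (V →ₗ[(MonoidAlgebra k G)ᵐᵒᵖ] U) ≃ₗ[k]
    (rightRepresentation k G V).IntertwiningMap (rightRepresentation k G U) where
  toFun f := ⟨f.restrictScalars k, fun g => LinearMap.ext fun v => map_smul f (rsingle k g⁻¹) v⟩
  invFun f := rightLinear f.toLinearMap fun g v => by
    have h : f.toLinearMap (rsingle k g⁻¹⁻¹ • v) = rsingle k g⁻¹⁻¹ • f.toLinearMap v :=
      LinearMap.congr_fun (f.isIntertwining' g⁻¹) v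
    rwa [inv_inv] at h
  map_add' _ _ := rfl
  map_smul' _ _ := rfl

theorem finrank_hom_eq_sum_actionTrace [Fintype G] [NeZero (Nat.card G : k)]
    [FiniteDimensional k V] [FiniteDimensional k U] :
    (Module.finrank k (V →ₗ[(MonoidAlgebra k G)ᵐᵒᵖ] U) : k) =
      1 / (Nat.card G : k) * ∑ g : G, actionTrace k V (MonoidAlgebra.single g⁻¹ 1) *
        actionTrace k U (MonoidAlgebra.single g 1) := by
  have : Invertible (Nat.card G : k) := invertibleOfNonzero (NeZero.ne _)
  rw [homEquivIntertwiningMap.finrank_eq,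
    ← Representation.card_inv_mul_sum_char_mul_char_eq_finrank, one_div]
  exact congrArg _ (Fintype.sum_equiv (Equiv.inv G) _ _ fun g => mul_comm _ _)

theorem finiteDimensional_of_isSimpleModule [Finite G]
    [IsSimpleModule (MonoidAlgebra k G)ᵐᵒᵖ V] : FiniteDimensional k V :=
  have : Module.Finite k (MonoidAlgebra k G) :=
    Module.Finite.equiv (MonoidAlgebra.coeffLinearEquiv k).symm
  have : Module.Finite k (MonoidAlgebra k G)ᵐᵒᵖ :=
    Module.Finite.equiv (MulOpposite.opLinearEquiv k)
  Module.Finite.trans (MonoidAlgebra k G)ᵐᵒᵖ V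

end GroupModules

section ApexTrace

variable {k : Type*} [Field k] {S : Type*} [Monoid S] {e : Idem S}
  {η : MonoidAlgebra k S}
  {N : Type*} [AddCommGroup N] [Module (MonoidAlgebra k S)ᵐᵒᵖ N] [Module k N]
  [IsScalarTower k (MonoidAlgebra k S)ᵐᵒᵖ N] [FiniteDimensional k N]

theorem IsSplitting.actionTrace_apexPart (hη : IsSplitting e η) (g : MaxSubgroup e) :
    actionTrace k (apexPart k e N) (MonoidAlgebra.single g 1) =
      actionTrace k N (η * MonoidAlgebra.single g.toS 1) := by
  have hmem (x : N) : op (η * MonoidAlgebra.single g.toS 1) • x ∈ apexPart k e N := by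
    rw [MulOpposite.op_mul, mul_smul]
    exact apexPart.toS_smul_mem g (hη.smul_mem x)
  rw [actionTrace_apply, actionTrace_apply, ← LinearMap.trace_restrict_eq_of_forall_mem
    (apexPart k e N) (Algebra.lsmul k k N _) hmem]
  refine congrArg _ (LinearMap.ext fun x => Subtype.ext ?_)
  refine (apexPart.coe_rsingle_smul g x).trans ?_
  change _ = op (η * MonoidAlgebra.single g.toS 1) • (x : N)
  rw [MulOpposite.op_mul, mul_smul, hη.smul_eq_self]

end ApexTrace

/-! ### Projectivity and indecomposability -/

section Projective

variable {k : Type*} [Field k] {S : Type*} [Monoid S] {e : Idem S}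

theorem IsSplitting.apexPart_map_surjective {η : MonoidAlgebra k S} (hη : IsSplitting e η)
    {N : Type*} [AddCommGroup N] [Module (MonoidAlgebra k S)ᵐᵒᵖ N] [Module k N]
    [IsScalarTower k (MonoidAlgebra k S)ᵐᵒᵖ N]
    {N' : Type*} [AddCommGroup N'] [Module (MonoidAlgebra k S)ᵐᵒᵖ N'] [Module k N']
    [IsScalarTower k (MonoidAlgebra k S)ᵐᵒᵖ N'] {f : N →ₗ[(MonoidAlgebra k S)ᵐᵒᵖ] N'}
    (hf : Function.Surjective f) : Function.Surjective (apexPart.map (e := e) f) := fun y => by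
  obtain ⟨x, hx⟩ := hf y
  exact ⟨⟨op η • x, hη.smul_mem x⟩, Subtype.ext <| by
    rw [apexPart.coe_map, map_smul, hx, hη.smul_eq_self]⟩

variable {V : Type*} [AddCommGroup V] [Module k V]
  [Module (MonoidAlgebra k (MaxSubgroup e))ᵐᵒᵖ V]
  [IsScalarTower k (MonoidAlgebra k (MaxSubgroup e))ᵐᵒᵖ V]

namespace Ind

theorem projective {η : MonoidAlgebra k S} (hη : IsSplitting e η)
    [Module.Projective (MonoidAlgebra k (MaxSubgroup e))ᵐᵒᵖ V] :
    Module.Projective (MonoidAlgebra k S)ᵐᵒᵖ (Ind k e V) := by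
  refine Module.Projective.of_lifting_property'' fun p hp => ?_
  obtain ⟨φ, hφ⟩ := Module.projective_lifting_property (apexPart.map p) (unit k e V)
    (hη.apexPart_map_surjective hp)
  refine ⟨ofHom φ, (homEquiv e V _).injective (LinearMap.ext fun v => ?_)⟩
  calc homEquiv e V (Ind k e V) (p ∘ₗ ofHom φ) v
      = apexPart.map p (homEquiv e V _ (ofHom φ) v) := rfl
    _ = apexPart.map p (φ v) := by rw [show homEquiv e V _ (ofHom φ) = φ from
        (homEquiv e V _).apply_symm_apply φ]
    _ = unit k e V v := LinearMap.congr_fun hφ v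

variable [Finite S] [IsSimpleModule (MonoidAlgebra k (MaxSubgroup e))ᵐᵒᵖ V]

theorem nontrivial (hS : IsRightRegularBandOfGroups S) : Nontrivial (Ind k e V) :=
  have := IsSimpleModule.nontrivial (MonoidAlgebra k (MaxSubgroup e))ᵐᵒᵖ V
  (Subtype.val_injective.comp (unit_bijective (k := k) (e := e) (W := V) hS).injective).nontrivial

theorem eq_zero_or_eq_id_of_isIdempotentElem (hS : IsRightRegularBandOfGroups S)
    {π : Module.End (MonoidAlgebra k S)ᵐᵒᵖ (Ind k e V)} (hπ : IsIdempotentElem π) :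
    π = 0 ∨ π = LinearMap.id := by
  have := IsSimpleModule.congr (unitEquiv (k := k) (e := e) (W := V) hS).symm
  refine (LinearMap.bijective_or_eq_zero (apexPart.map (e := e) π)).symm.imp (fun h => ?_)
    fun h => ?_
  all_goals refine (homEquiv e V (Ind k e V)).injective (LinearMap.ext fun v => ?_)
  · exact LinearMap.congr_fun h (unit k e V v)
  · exact h.injective (Subtype.ext (LinearMap.congr_fun hπ (unit k e V v : Ind k e V)))

theorem isProjectiveIndecomposable (hS : IsRightRegularBandOfGroups S)
    {η : MonoidAlgebra k S} (hη : IsSplitting e η)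
    [NeZero (Nat.card (MaxSubgroup e) : k)] :
    IsProjectiveIndecomposable (MonoidAlgebra k S) (Ind k e V) where
  projective :=
    have : Module.Projective (MonoidAlgebra k (MaxSubgroup e))ᵐᵒᵖ V :=
      Module.projective_of_isSemisimpleRing _ _
    projective hη
  nontrivial := nontrivial hS
  indecomposable N N' h := by
    refine (eq_zero_or_eq_id_of_isIdempotentElem hS (N.isIdempotentElem_projection h)).imp ?_ ?_
    · intro h0
      rw [← N.range_projection h, h0, LinearMap.range_zero]
    · intro h1
      rw [← N.ker_projection h, h1, LinearMap.ker_id]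

end Ind

end Projective

section Schur

variable {k : Type*} [Field k] {A : Type*} [Ring A] [Algebra k A]
  {V : Type*} [AddCommGroup V] [Module k V] [Module A V] [IsScalarTower k A V]
  {U : Type*} [AddCommGroup U] [Module k U] [Module A U] [IsScalarTower k A U]

/-- Composition with an isomorphism `φ`, as a `k`-linear isomorphism of Hom spaces. -/
def homCongrRight {U' : Type*} [AddCommGroup U'] [Module k U'] [Module A U'] [IsScalarTower k A U']
    (φ : U ≃ₗ[A] U') : (V →ₗ[A] U) ≃ₗ[k] (V →ₗ[A] U') :=
  (LinearEquiv.arrowCongrAddEquiv (.refl A V) φ).toLinearEquiv fun c f =>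
    LinearMap.ext fun v => φ.toLinearMap.map_smul_of_tower c (f v)

open Classical in
theorem finrank_hom_of_isSimpleModule [IsSimpleModule A V] [IsSimpleModule A U] :
    Module.finrank k (V →ₗ[A] U) =
      if Nonempty (V ≃ₗ[A] U) then Module.finrank k (Module.End A V) else 0 := by
  split_ifs with h
  · obtain ⟨φ⟩ := h
    exact (homCongrRight φ).finrank_eq.symm
  · have : Subsingleton (V →ₗ[A] U) := subsingleton_of_forall_eq 0 fun f =>
      f.bijective_or_eq_zero.resolve_left fun hf => h ⟨.ofBijective f hf⟩
    exact Module.finrank_zero_of_subsingleton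

theorem finrank_end_of_isAlgClosed [IsAlgClosed k] [IsSimpleModule A V] [FiniteDimensional k V] :
    Module.finrank k (Module.End A V) = 1 := by
  rw [← (LinearEquiv.ofBijective (Algebra.linearMap k (Module.End A V))
    (IsSimpleModule.algebraMap_end_bijective_of_isAlgClosed k)).finrank_eq, Module.finrank_self]

end Schur

/-! ### Cartan invariants -/

section Cartan

variable {k : Type*} [Field k] {S : Type*} [Monoid S] {e e' : Idem S}
  {V : Type*} [AddCommGroup V] [Module k V] [Module (MonoidAlgebra k (MaxSubgroup e))ᵐᵒᵖ V]
  [IsScalarTower k (MonoidAlgebra k (MaxSubgroup e))ᵐᵒᵖ V]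

theorem cartanInvariant_ind_of_not_jLe (h : ¬ JLe e'.1 e.1) {W : Type*} [AddCommGroup W]
    [Module k W] [Module (MonoidAlgebra k (MaxSubgroup e'))ᵐᵒᵖ W] :
    cartanInvariant k (MonoidAlgebra k S) (Ind k e V) (Ind k e' W) = 0 := by
  have : Subsingleton (apexPart k e (Ind k e' W)) := subsingleton_of_forall_eq 0 fun x =>
    Subtype.ext ((apexPart.idem_smul x).symm.trans (Ind.rsingle_smul_eq_zero h _))
  rw [cartanInvariant, (Ind.homEquiv e V (Ind k e' W)).finrank_eq,
    Module.finrank_zero_of_subsingleton]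

theorem cartanInvariant_ind_self [Finite S] (hS : IsRightRegularBandOfGroups S) {W : Type*}
    [AddCommGroup W] [Module k W] [Module (MonoidAlgebra k (MaxSubgroup e))ᵐᵒᵖ W]
    [IsScalarTower k (MonoidAlgebra k (MaxSubgroup e))ᵐᵒᵖ W] :
    cartanInvariant k (MonoidAlgebra k S) (Ind k e V) (Ind k e W) =
      Module.finrank k (V →ₗ[(MonoidAlgebra k (MaxSubgroup e))ᵐᵒᵖ] W) :=
  ((Ind.homEquiv e V (Ind k e W)).trans (homCongrRight (Ind.unitEquiv hS).symm)).finrank_eq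

theorem sameModule_iff {n : ℕ} {e : Fin n → Idem S} {i : Fin n}
    {V : Type*} [AddCommGroup V] [Module k V]
    [Module (MonoidAlgebra k (MaxSubgroup (e i)))ᵐᵒᵖ V]
    [IsScalarTower k (MonoidAlgebra k (MaxSubgroup (e i)))ᵐᵒᵖ V]
    {W : Type*} [AddCommGroup W] [Module k W]
    [Module (MonoidAlgebra k (MaxSubgroup (e i)))ᵐᵒᵖ W]
    [IsScalarTower k (MonoidAlgebra k (MaxSubgroup (e i)))ᵐᵒᵖ W] :
    SameModule k e i i V W ↔
      Nonempty (V ≃ₗ[(MonoidAlgebra k (MaxSubgroup (e i)))ᵐᵒᵖ] W) := by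
  constructor
  · rintro ⟨-, φ, hφ⟩
    exact ⟨.ofBijective (rightLinear φ.toLinearMap fun g v => hφ g g rfl v) φ.bijective⟩
  · rintro ⟨φ⟩
    refine ⟨rfl, φ.restrictScalars k, fun g h hgh v => ?_⟩
    rw [MaxSubgroup.toS_injective hgh]
    exact map_smul φ (rsingle k h) v

end Cartan

section Formula

variable {k : Type*} [Field k] {S : Type*} [Monoid S]

open Classical in
theorem Ind.actionTrace_mul_idem [Fintype S] {e : Idem S} {W : Type*} [AddCommGroup W] [Module k W]
    [Module (MonoidAlgebra k (MaxSubgroup e))ᵐᵒᵖ W]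
    [IsScalarTower k (MonoidAlgebra k (MaxSubgroup e))ᵐᵒᵖ W] [FiniteDimensional k W]
    (hS : IsRightRegularBandOfGroups S) {s t : S} (ht : IsIdempotentElem t)
    (hs : JLe e.1 s) (het : JLe e.1 t) :
    actionTrace k (Ind k e W) (MonoidAlgebra.single s 1 * MonoidAlgebra.single t 1) =
      ∑ f : S with IsIdempotentElem f ∧ JEquiv f e.1 ∧ omegaPow (f * s * t) = f,
        characterS k e W (f * s * e.1) := by
  rw [MonoidAlgebra.single_mul_single, one_mul, actionTrace_ind hS]
  simp only [← mul_assoc]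
  refine Finset.sum_congr rfl fun f hf => ?_
  have hfe : JLe e.1 f := (Finset.mem_filter.1 hf).2.2.1.ge
  rw [← characterS_toS, hS.toS_toMaxSubgroup (hS.jLe_mul_iff.2 ⟨hS.jLe_mul_iff.2 ⟨hfe, hs⟩, het⟩),
    mul_assoc (f * s), (hS.jLe_idem_iff ht).1 het]

theorem Ind.actionTrace_mul_single_eq_zero {e : Idem S} {W : Type*} [AddCommGroup W] [Module k W]
    [Module (MonoidAlgebra k (MaxSubgroup e))ᵐᵒᵖ W] {t : S} (ht : ¬ JLe e.1 t)
    (x : MonoidAlgebra k S) :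
    actionTrace k (Ind k e W) (x * MonoidAlgebra.single t 1) = 0 := by
  rw [actionTrace_apply, ← map_zero (LinearMap.trace k (Ind k e W))]
  refine congrArg _ (LinearMap.ext fun w => ?_)
  exact (mul_smul (rsingle k t) (op x) w).trans (rsingle_smul_eq_zero ht _)

theorem cartanInvariant_eq_cartanFormula [Fintype S] {n : ℕ} {e : Fin n → Idem S}
    (hS : IsRightRegularBandOfGroups S) (he : IsJTransversal e) {i l : Fin n}
    [NeZero (Nat.card (MaxSubgroup (e i)) : k)] (hli : JLe (e l).1 (e i).1)
    {V : Type*} [AddCommGroup V] [Module k V] [Module (MonoidAlgebra k (MaxSubgroup (e i)))ᵐᵒᵖ V]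
    [IsScalarTower k (MonoidAlgebra k (MaxSubgroup (e i)))ᵐᵒᵖ V] [FiniteDimensional k V]
    {W : Type*} [AddCommGroup W] [Module k W] [Module (MonoidAlgebra k (MaxSubgroup (e l)))ᵐᵒᵖ W]
    [IsScalarTower k (MonoidAlgebra k (MaxSubgroup (e l)))ᵐᵒᵖ W] [FiniteDimensional k W] :
    (cartanInvariant k (MonoidAlgebra k S) (Ind k (e i) V) (Ind k (e l) W) : k) =
      cartanFormula k e i l V W := by
  classical
  have := Ind.finiteDimensional (k := k) (e := e l) (W := W) hS
  rw [cartanInvariant, (Ind.homEquiv (e i) V _).finrank_eq, finrank_hom_eq_sum_actionTrace,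
    cartanFormula]
  refine congrArg _ (Finset.sum_congr rfl fun g _ => congrArg (character k (e i) V g⁻¹ * ·) ?_)
  rw [(isSplitting_splitting he hS i).actionTrace_apexPart,
    trace_splitting_mul hS he actionTrace_mul_comm]
  symm
  refine (Finset.sum_congr (by congr) fun m hm => ?_).trans <| Finset.sum_subset
    (Finset.monotone_filter_right _ fun m _ (hm : JLe (e l).1 (e m).1 ∧ _) => hm.2)
    fun m hm hlm => ?_
  · rw [Ind.actionTrace_mul_idem hS (e m).2 (hli.trans g.jEquiv_toS.le)
      (Finset.mem_filter.1 hm).2.1]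
  · rw [Ind.actionTrace_mul_single_eq_zero fun h => hlm <| Finset.mem_filter.2
      ⟨Finset.mem_univ _, h, (Finset.mem_filter.1 hm).2⟩, mul_zero]

end Formula

end RRBG

end

open Classical in
theorem theorem5p5_general {k : Type*} [Field k] {S : Type*} [Monoid S] [Fintype S]
    (hS : IsRightRegularBandOfGroups S) {n : ℕ} (e : Fin n → Idem S) (he : IsJTransversal e)
    (i l : Fin n) [NeZero (Nat.card (MaxSubgroup (e i)) : k)]
    [NeZero (Nat.card (MaxSubgroup (e l)) : k)]
    (V : Type*) [AddCommGroup V] [Module k V]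
    [Module (MonoidAlgebra k (MaxSubgroup (e i)))ᵐᵒᵖ V]
    [IsScalarTower k (MonoidAlgebra k (MaxSubgroup (e i)))ᵐᵒᵖ V]
    [IsSimpleModule (MonoidAlgebra k (MaxSubgroup (e i)))ᵐᵒᵖ V]
    (W : Type*) [AddCommGroup W] [Module k W]
    [Module (MonoidAlgebra k (MaxSubgroup (e l)))ᵐᵒᵖ W]
    [IsScalarTower k (MonoidAlgebra k (MaxSubgroup (e l)))ᵐᵒᵖ W]
    [IsSimpleModule (MonoidAlgebra k (MaxSubgroup (e l)))ᵐᵒᵖ W] :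
    IsProjectiveIndecomposable (MonoidAlgebra k S) (Ind k (e i) V) ∧
    IsProjectiveIndecomposable (MonoidAlgebra k S) (Ind k (e l) W) ∧
    (cartanInvariant k (MonoidAlgebra k S) (Ind k (e i) V) (Ind k (e l) W) : k) =
      if JLt (e l).1 (e i).1 then cartanFormula k e i l V W
      else if SameModule k e i l V W then
        (Module.finrank k (Module.End (MonoidAlgebra k (MaxSubgroup (e i)))ᵐᵒᵖ V) : k)
      else 0 := by
  refine ⟨Ind.isProjectiveIndecomposable hS (isSplitting_splitting he hS i),
    Ind.isProjectiveIndecomposable hS (isSplitting_splitting he hS l), ?_⟩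
  have : FiniteDimensional k V := finiteDimensional_of_isSimpleModule (G := MaxSubgroup (e i))
  have : FiniteDimensional k W := finiteDimensional_of_isSimpleModule (G := MaxSubgroup (e l))
  split_ifs with hlt hVW
  · exact cartanInvariant_eq_cartanFormula hS he hlt.1
  · obtain rfl : i = l := hVW.1
    rw [cartanInvariant_ind_self hS, finrank_hom_of_isSimpleModule, if_pos (sameModule_iff.1 hVW)]
  · by_cases hil : i = l
    · subst hil
      rw [cartanInvariant_ind_self hS, finrank_hom_of_isSimpleModule,
        if_neg (mt sameModule_iff.2 hVW), Nat.cast_zero]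
    · rw [cartanInvariant_ind_of_not_jLe fun h => (he.jLe_iff.1 h).elim (hil ∘ Eq.symm) hlt,
        Nat.cast_zero]

open Classical in
theorem theorem5p5 {k : Type*} [Field k] [IsAlgClosed k] [CharZero k]
    {S : Type*} [Monoid S] [Fintype S] (hS : IsRightRegularBandOfGroups S)
    {n : ℕ} (e : Fin n → Idem S) (he : IsJTransversal e) (i l : Fin n)
    (V : Type*) [AddCommGroup V] [Module k V]
    [Module (MonoidAlgebra k (MaxSubgroup (e i)))ᵐᵒᵖ V]
    [IsScalarTower k (MonoidAlgebra k (MaxSubgroup (e i)))ᵐᵒᵖ V]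
    [IsSimpleModule (MonoidAlgebra k (MaxSubgroup (e i)))ᵐᵒᵖ V]
    (W : Type*) [AddCommGroup W] [Module k W]
    [Module (MonoidAlgebra k (MaxSubgroup (e l)))ᵐᵒᵖ W]
    [IsScalarTower k (MonoidAlgebra k (MaxSubgroup (e l)))ᵐᵒᵖ W]
    [IsSimpleModule (MonoidAlgebra k (MaxSubgroup (e l)))ᵐᵒᵖ W] :
    IsProjectiveIndecomposable (MonoidAlgebra k S) (Ind k (e i) V) ∧
    IsProjectiveIndecomposable (MonoidAlgebra k S) (Ind k (e l) W) ∧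
    (cartanInvariant k (MonoidAlgebra k S) (Ind k (e i) V) (Ind k (e l) W) : k) =
      if JLt (e l).1 (e i).1 then cartanFormula k e i l V W
      else if SameModule k e i l V W then 1
      else 0 := by
  have := finiteDimensional_of_isSimpleModule (k := k) (G := MaxSubgroup (e i)) (V := V)
  simpa only [finrank_end_of_isAlgClosed, Nat.cast_one] using
    theorem5p5_general (k := k) hS e he i l V W
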